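/- Let $\mathbb{H}$ be the quaternions, $\mathbb{S}$ the set of purely imaginary quaternions of norm $1$, and $\mathbb{C}_I=\{x+Iy:\ x,y\in\mathbb{R}\}$, with area measure $dm_I$, for $I\in\mathbb{S}$. Put $e^{It}=\cos t+I\sin t$. For $q\in\mathbb{H}\setminus\mathbb{R}$ let $I_q\in\mathbb{S}$ be the normalized imaginary part of $q$; for $q\in\mathbb{R}$ let $I_q$ be an arbitrary fixed element of $\mathbb{S}$. A function $f:\mathbb{H}\to\mathbb{H}$ is entire slice regular if it is real differentiable and $\left(\frac{\partial}{\partial x}+I\frac{\partial}{\partial y}\right)f(x+Iy)=0$ for all $I\in\mathbb{S}$ and $x,y\in\mathbb{R}$. For $1\le p<\infty$, $\alpha>0$ and $I\in\mathbb{S}$ let $$\|f\|_{p,\alpha,I}=\Big(\frac{\alpha p}{2\pi}\int_{\mathbb{C}_I}|f(q)|^p\,(e^{-\alpha|q|^2/2})^p\,dm_I(q)\Big)^{1/p},$$ and let $\mathcal{F}^{\alpha,p}_{Slice}(\mathbb{H})$ be the set of entire slice regular $f$ with $\|f\|_{p,\alpha,I}<\infty$ for some $I\in\mathbb{S}$.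 For $k,n\ge 1$ and $\delta>0$ put $$\omega_k(f;\delta)_{\mathcal{F}^p_{\alpha,I}}=\sup_{h\in\mathbb{R},\,|h|\le\delta}\Big(\int_{\mathbb{C}_I}\Big|\sum_{s=0}^k(-1)^{k+s}\binom ks f(ze^{Ish})\Big|^p\,(e^{-\alpha|z|^2/2})^p\,dm_I(z)\Big)^{1/p},$$ $$E_n(f)_{p,\alpha,I}=\inf_{P\in\mathcal{P}_n}\|f-P\|_{p,\alpha,I},$$ where $\mathcal{P}_d$ is the set of quaternionic polynomials $q\mapsto\sum_{k=0}^{d}q^ka_k$, $a_k\in\mathbb{H}$, of degree $\le d$. For integers $n,r\ge1$ and $m\ge0$ put $$F_n(f)(q)=\int_{-\pi}^{\pi}f(qe^{I_qt})\,\frac1{2\pi n}\Big(\frac{\sin(nt/2)}{\sin(t/2)}\Big)^2dt,\qquad V_n(f)=2F_{2n}(f)-F_n(f),$$ $$I_{n,m,r}(f)(q)=-\int_{-\pi}^{\pi}K_{n,r}(t)\sum_{k=1}^{m+1}(-1)^k\binom{m+1}k f(qe^{I_qkt})\,dt,\qquad K_{n,r}(t)=\frac1{\lambda_{n,r}}\Big(\frac{\sin(nt/2)}{\sin(t/2)}\Big)^{2r},$$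 with $\lambda_{n,r}$ chosen so that $\int_{-\pi}^{\pi}K_{n,r}(t)\,dt=1$. **Theorem 4.5.** Let $1\le p<\infty$. (i) Let $m\ge0$ be an integer and let $r$ be the smallest integer with $r\ge\frac{p(m+1)+2}{2}$. There is a constant $C_{p,m,r}>0$, depending only on $p,m,r$, such that for all $\alpha>0$, all $f\in\mathcal{F}^{\alpha,p}_{Slice}(\mathbb{H})$ and all integers $n\ge1$, $I_{n,m,r}(f)$ is a quaternionic polynomial of degree $\le r(n-1)$, and for every $I\in\mathbb{S}$ $$\|I_{n,m,r}(f)-f\|_{p,\alpha,I}\le C_{p,m,r}\Big(\frac{\alpha p}{2\pi}\Big)^{1/p}\,\omega_{m+1}\Big(f;\frac1n\Big)_{\mathcal{F}^p_{\alpha,I}}.$$ (ii) For all $\alpha>0$, all $f\in\mathcal{F}^{\alpha,p}_{Slice}(\mathbb{H})$ and all integers $n\ge1$, $V_n(f)$ is a quaternionic polynomial of degree $\le 2n-1$, and for every $I\in\mathbb{S}$ $$\|V_n(f)-f\|_{p,\alpha,I}\le\Big[2^{(p-1)/p}(2^p+1)^{1/p}+1\Big]\,E_n(f)_{p,\alpha,I}.$$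 -/

import Mathlib

open scoped Quaternion ENNReal

noncomputable section

namespace SliceFock

/-- The sphere `𝕊` of purely imaginary unit quaternions. -/
def imagSphere : Set ℍ[ℝ] := {q | q.re = 0 ∧ ‖q‖ = 1}

/-- The point `x + I y` of the complex plane `ℂ_I` that corresponds to `z = x + i y`. For `I ∈ 𝕊` this
is an isometry of `ℂ` onto `ℂ_I`, so the area measure of `ℂ_I` corresponds to `volume` on `ℂ`. -/
def slicePoint (I : ℍ[ℝ]) (z : ℂ) : ℍ[ℝ] := (z.re : ℍ[ℝ]) + I * (z.im : ℍ[ℝ])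

/-- `e^{I t} = cos t + I sin t`. -/
def expUnit (I : ℍ[ℝ]) (t : ℝ) : ℍ[ℝ] := (Real.cos t : ℍ[ℝ]) + I * (Real.sin t : ℍ[ℝ])

/-- The imaginary unit `I_q` of `q`: the normalized imaginary part when `q` is not real, and the
arbitrary fixed unit `I₀` when `q` is real. -/
def imagUnit (I₀ q : ℍ[ℝ]) : ℍ[ℝ] :=
  open Classical in if q.im = 0 then I₀ else (‖q.im‖⁻¹ : ℝ) • q.im

/-- Entire (left) slice regular functions: real differentiable on the quaternions, and on each
`ℂ_I` one has `(∂/∂x + I ∂/∂y) f_I (x + I y) = 0`; the partial derivatives of the restriction `f_I`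
are the derivatives of `f` in the directions `1` and `I`. -/
def SliceRegular (f : ℍ[ℝ] → ℍ[ℝ]) : Prop :=
  Differentiable ℝ f ∧ ∀ I ∈ imagSphere, ∀ z : ℂ,
    fderiv ℝ f (slicePoint I z) 1 + I * fderiv ℝ f (slicePoint I z) I = 0

/-- `∫ |g(z)|^p (e^{-α |z|² / 2})^p dA(z)` for `g` on a slice, in the coordinate `z = x + i y`. -/
def weightedIntegral (α p : ℝ) (g : ℂ → ℍ[ℝ]) : ℝ≥0∞ :=
  ∫⁻ z : ℂ, ‖g z‖ₑ ^ p * ENNReal.ofReal (Real.exp (-α * ‖z‖ ^ 2 / 2)) ^ p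

/-- `‖f‖_{p, α, I}`, with values in `[0, ∞]`. -/
def fockNorm (α p : ℝ) (I : ℍ[ℝ]) (f : ℍ[ℝ] → ℍ[ℝ]) : ℝ≥0∞ :=
  (ENNReal.ofReal (α * p / (2 * Real.pi)) *
    weightedIntegral α p (fun z => f (slicePoint I z))) ^ (1 / p)

/-- The slice regular Fock space of the second kind. -/
def fockSlice (α p : ℝ) : Set (ℍ[ℝ] → ℍ[ℝ]) :=
  {f | SliceRegular f ∧ ∃ I ∈ imagSphere, fockNorm α p I f < ⊤}

/-- The `k`-th rotational difference `∑_{s=0}^{k} (-1)^{k+s} (k choose s) f(q e^{I s h})`. -/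
def rotDiff (I : ℍ[ℝ]) (k : ℕ) (h : ℝ) (f : ℍ[ℝ] → ℍ[ℝ]) (q : ℍ[ℝ]) : ℍ[ℝ] :=
  ∑ s ∈ Finset.range (k + 1),
    ((-1 : ℝ) ^ (k + s) * (k.choose s : ℝ)) • f (q * expUnit I (s * h))

/-- The weighted `L^p` modulus of smoothness of order `k` on the slice `ℂ_I`. -/
def modulus (α p : ℝ) (I : ℍ[ℝ]) (k : ℕ) (f : ℍ[ℝ] → ℍ[ℝ]) (δ : ℝ) : ℝ≥0∞ :=
  ⨆ (h : ℝ) (_ : |h| ≤ δ),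
    weightedIntegral α p (fun z => rotDiff I k h f (slicePoint I z)) ^ (1 / p)

/-- Quaternionic polynomial functions `q ↦ ∑_{k ≤ d} q^k a_k`, of degree at most `d`, with the
coefficients on the right. -/
def polysDegreeLE (d : ℕ) : Set (ℍ[ℝ] → ℍ[ℝ]) :=
  {P | ∃ a : ℕ → ℍ[ℝ], ∀ q, P q = ∑ k ∈ Finset.range (d + 1), q ^ k * a k}

/-- The error `E_n(f)_{p, α, I}` of best approximation by polynomials of degree at most `n`. -/
def bestApprox (α p : ℝ) (I : ℍ[ℝ]) (n : ℕ) (f : ℍ[ℝ] → ℍ[ℝ]) : ℝ≥0∞ :=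
  ⨅ P ∈ polysDegreeLE n, fockNorm α p I (f - P)

/-- The Fejér kernel. -/
def fejerKernel (n : ℕ) (t : ℝ) : ℝ :=
  1 / (2 * Real.pi * n) * (Real.sin (n * t / 2) / Real.sin (t / 2)) ^ 2

/-- The constant `λ_{n, r}` that normalizes the generalized Jackson kernel. -/
def jacksonConst (n r : ℕ) : ℝ :=
  ∫ t in (-Real.pi)..Real.pi, (Real.sin (n * t / 2) / Real.sin (t / 2)) ^ (2 * r)

/-- The generalized Jackson kernel `K_{n, r}`. -/
def jacksonKernel (n r : ℕ) (t : ℝ) : ℝ :=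
  1 / jacksonConst n r * (Real.sin (n * t / 2) / Real.sin (t / 2)) ^ (2 * r)

/-- `F_n(f)(q) = ∫_{-π}^{π} f(q e^{I_q t}) K_n(t) dt` with the Fejér kernel `K_n`. -/
def fejerOp (I₀ : ℍ[ℝ]) (n : ℕ) (f : ℍ[ℝ] → ℍ[ℝ]) (q : ℍ[ℝ]) : ℍ[ℝ] :=
  ∫ t in (-Real.pi)..Real.pi, fejerKernel n t • f (q * expUnit (imagUnit I₀ q) t)

/-- `I_{n, m, r}(f)(q)
  = -∫_{-π}^{π} K_{n, r}(t) ∑_{k=1}^{m+1} (-1)^k (m+1 choose k) f(q e^{I_q k t}) dt`. -/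
def jacksonOp (I₀ : ℍ[ℝ]) (n m r : ℕ) (f : ℍ[ℝ] → ℍ[ℝ]) (q : ℍ[ℝ]) : ℍ[ℝ] :=
  -∫ t in (-Real.pi)..Real.pi, jacksonKernel n r t •
    ∑ k ∈ Finset.Icc 1 (m + 1),
      ((-1 : ℝ) ^ k * ((m + 1).choose k : ℝ)) • f (q * expUnit (imagUnit I₀ q) (k * t))

/-- `V_n(f) = 2 F_{2n}(f) - F_n(f)`. -/
def valleePoussinOp (I₀ : ℍ[ℝ]) (n : ℕ) (f : ℍ[ℝ] → ℍ[ℝ]) (q : ℍ[ℝ]) : ℍ[ℝ] :=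
  (2 : ℝ) • fejerOp I₀ (2 * n) f q - fejerOp I₀ n f q

end SliceFock

end

open SliceFock

noncomputable section

namespace SliceFock

/-! On each slice, slice regularity is holomorphy for the complex structure given by left
multiplication by `ℂ_I`, so `f` has an everywhere convergent Taylor series there. All slices share
the real axis, which forces the coefficients to agree: `f q = ∑ q^k a_k` on all of `ℍ`.

Replacing `q` by `q e^{It}` turns `q^k` into `q^k e^{Ikt}`. Averaging against an even kernel cancels
the sine part, so `a_k` is only multiplied by a real cosine coefficient. Hence the averages do not
depend on the unit `I` chosen at `q`, and a kernel that is a cosine polynomial of degree `d`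
produces a polynomial in `q` of degree at most `d`.

The norm estimates rest on the rotation invariance of the Gaussian weight. For (i), `I_{n,m,r}(f) -
f` is, up to sign, the Jackson average of the rotational differences of order `m+1`. Jensen's
inequality reduces the claim to differences of step `t`, which are at most `(1 + n|t|)^{m+1}` times
the modulus at `1/n` (`weightedIntegral_rotDiff_le`). The choice of `r` makes the corresponding
kernel moment bounded in `n` (`lintegral_jacksonKernel_mul_le`).

For (ii), Fejér means are contractions, so `V_n` has norm at most `3`; it also fixes polynomials of
degree at most `n`. Thus `V_n f - f = V_n (f - P) - (f - P)` has norm at most `4‖f - P‖`, and `4` is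
at most the stated constant. -/

/-! ### Slices as isometric copies of the complex plane. -/

lemma mul_self_of_mem_imagSphere {I : ℍ[ℝ]} (hI : I ∈ imagSphere) : I * I = -1 := by
  obtain ⟨h0, h1⟩ := hI
  have h2 : star I = -I := by
    ext <;> simp [h0]
  have h3 := Quaternion.self_mul_star I
  rw [h2, mul_neg, Quaternion.normSq_eq_norm_mul_self, h1] at h3
  rw [← neg_neg (I * I), h3]; simp

lemma norm_slicePoint {I : ℍ[ℝ]} (hI : I ∈ imagSphere) (z : ℂ) : ‖slicePoint I z‖ = ‖z‖ := by
  have hI2 : I.imI * I.imI + I.imJ * I.imJ + I.imK * I.imK = 1 := by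
    have h := congrArg QuaternionAlgebra.re (mul_self_of_mem_imagSphere hI)
    have h0 : I.re = 0 := hI.1
    simp [h0] at h
    linarith
  have h1 : ‖slicePoint I z‖ * ‖slicePoint I z‖ = ‖z‖ * ‖z‖ := by
    rw [← Quaternion.normSq_eq_norm_mul_self, Complex.norm_mul_self_eq_normSq,
      Quaternion.normSq_def', Complex.normSq_apply]
    have h0 : I.re = 0 := hI.1
    simp [slicePoint, h0]
    linear_combination z.im * z.im * hI2
  exact (mul_self_inj (norm_nonneg _) (norm_nonneg _)).1 h1

/-- The embedding of `ℂ` onto the slice `ℂ_I` as an algebra homomorphism. -/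
def sliceHom (I : ℍ[ℝ]) (hI : I ∈ imagSphere) : ℂ →ₐ[ℝ] ℍ[ℝ] :=
  Complex.lift ⟨I, mul_self_of_mem_imagSphere hI⟩

lemma sliceHom_apply {I : ℍ[ℝ]} (hI : I ∈ imagSphere) (z : ℂ) :
    sliceHom I hI z = slicePoint I z := by
  simp only [sliceHom, Complex.lift_apply, Complex.liftAux_apply, slicePoint]
  rw [← Quaternion.coe_mul_eq_smul, ← Quaternion.coe_commutes]
  rfl

lemma slicePoint_mul {I : ℍ[ℝ]} (hI : I ∈ imagSphere) (z w : ℂ) :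
    slicePoint I (z * w) = slicePoint I z * slicePoint I w := by
  simp only [← sliceHom_apply hI, map_mul]

lemma slicePoint_sub {I : ℍ[ℝ]} (hI : I ∈ imagSphere) (z w : ℂ) :
    slicePoint I (z - w) = slicePoint I z - slicePoint I w := by
  simp only [← sliceHom_apply hI, map_sub]

lemma slicePoint_pow {I : ℍ[ℝ]} (hI : I ∈ imagSphere) (z : ℂ) (n : ℕ) :
    slicePoint I (z ^ n) = slicePoint I z ^ n := by
  simp only [← sliceHom_apply hI, map_pow]

lemma slicePoint_ofReal (I : ℍ[ℝ]) (x : ℝ) : slicePoint I (x : ℂ) = (x : ℍ[ℝ]) := by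
  simp [slicePoint]

lemma slicePoint_exp (I : ℍ[ℝ]) (t : ℝ) :
    slicePoint I (Complex.exp (t * Complex.I)) = expUnit I t := by
  simp [slicePoint, expUnit, Complex.exp_ofReal_mul_I_re, Complex.exp_ofReal_mul_I_im]

lemma slicePoint_mul_expUnit {I : ℍ[ℝ]} (hI : I ∈ imagSphere) (z : ℂ) (t : ℝ) :
    slicePoint I z * expUnit I t = slicePoint I (z * Complex.exp (t * Complex.I)) := by
  rw [slicePoint_mul hI, slicePoint_exp]

lemma continuous_slicePoint (I : ℍ[ℝ]) : Continuous (slicePoint I) := by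
  unfold slicePoint
  exact (Quaternion.continuous_coe.comp Complex.continuous_re).add
    (continuous_const.mul (Quaternion.continuous_coe.comp Complex.continuous_im))

lemma continuous_expUnit (I : ℍ[ℝ]) : Continuous (expUnit I) := by
  unfold expUnit
  exact (Quaternion.continuous_coe.comp Real.continuous_cos).add
    (continuous_const.mul (Quaternion.continuous_coe.comp Real.continuous_sin))

lemma imagUnit_mem {I₀ : ℍ[ℝ]} (hI₀ : I₀ ∈ imagSphere) (q : ℍ[ℝ]) :
    imagUnit I₀ q ∈ imagSphere := by
  unfold imagUnit
  split_ifs with h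
  · exact hI₀
  · refine ⟨by simp, ?_⟩
    rw [norm_smul, norm_inv, norm_norm, inv_mul_cancel₀ (norm_ne_zero_iff.2 h)]

lemma exists_slicePoint_imagUnit (I₀ q : ℍ[ℝ]) : ∃ z, q = slicePoint (imagUnit I₀ q) z := by
  unfold imagUnit
  split_ifs with h
  · refine ⟨(q.re : ℂ), ?_⟩
    rw [slicePoint_ofReal]
    conv_lhs => rw [← Quaternion.re_add_im q, h, add_zero]
  · refine ⟨⟨q.re, ‖q.im‖⟩, ?_⟩
    have : ((‖q.im‖⁻¹ : ℝ) • q.im) * ((‖q.im‖ : ℝ) : ℍ[ℝ]) = q.im := by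
      rw [← Quaternion.coe_commutes, Quaternion.coe_mul_eq_smul, smul_smul,
        mul_inv_cancel₀ (norm_ne_zero_iff.2 h), one_smul]
    simp only [slicePoint, this]
    exact (Quaternion.re_add_im q).symm

/-! ### Global power series of slice regular functions. -/

/-- `f` is given on all of `ℍ` by the power series with right coefficients `a`. -/
def HasPowerSeries (a : ℕ → ℍ[ℝ]) (f : ℍ[ℝ] → ℍ[ℝ]) : Prop :=
  ∀ q, HasSum (fun k => q ^ k * a k) (f q)

/-- Left multiplication by elements of `ℂ_I` makes `ℍ` a complex normed space. -/
@[reducible] def sliceNormedSpace (I : ℍ[ℝ]) (hI : I ∈ imagSphere) : NormedSpace ℂ ℍ[ℝ] :=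
  { Module.compHom ℍ[ℝ] (sliceHom I hI).toRingHom with
    norm_smul_le := fun c q => by
      change ‖sliceHom I hI c * q‖ ≤ ‖c‖ * ‖q‖
      rw [sliceHom_apply, norm_mul, norm_slicePoint hI] }

/-- The Cauchy–Riemann equation gives `df(I) = I df(1)`, so on the slice the real differential is
complex linear for left multiplication. -/
lemma SliceRegular.fderiv_slicePoint {f : ℍ[ℝ] → ℍ[ℝ]} (hf : SliceRegular f) {I : ℍ[ℝ]}
    (hI : I ∈ imagSphere) (z w : ℂ) :
    fderiv ℝ f (slicePoint I z) (slicePoint I w)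
      = slicePoint I w * fderiv ℝ f (slicePoint I z) 1 := by
  have h := hf.2 I hI z
  have h1 : fderiv ℝ f (slicePoint I z) I = I * fderiv ℝ f (slicePoint I z) 1 := by
    rw [eq_neg_of_add_eq_zero_left h, mul_neg, ← mul_assoc, mul_self_of_mem_imagSphere hI]
    simp
  have h2 : slicePoint I w = w.re • (1 : ℍ[ℝ]) + w.im • I := by
    rw [slicePoint, ← Quaternion.coe_commutes, Quaternion.coe_mul_eq_smul]
    congr 1
    rw [← Quaternion.coe_mul_eq_smul, mul_one]
  rw [h2, map_add, map_smul, map_smul, h1, add_mul, smul_mul_assoc, smul_mul_assoc, one_mul]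

lemma SliceRegular.exists_hasSum_slice {f : ℍ[ℝ] → ℍ[ℝ]} (hf : SliceRegular f) {I : ℍ[ℝ]}
    (hI : I ∈ imagSphere) :
    ∃ a : ℕ → ℍ[ℝ], ∀ z, HasSum (fun k => slicePoint I z ^ k * a k) (f (slicePoint I z)) := by
  let _ := sliceNormedSpace I hI
  have smul_def (c : ℂ) (q : ℍ[ℝ]) : c • q = slicePoint I c * q := by
    rw [← sliceHom_apply hI]; rfl
  have hd : Differentiable ℂ (fun z => f (slicePoint I z)) := by
    intro z
    refine HasDerivAt.differentiableAt (f' := fderiv ℝ f (slicePoint I z) 1) ?_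
    -- The real differentiability estimate pulls back to `ℂ` because `slicePoint I` is isometric.
    rw [hasDerivAt_iff_isLittleO]
    have h := (hf.1 (slicePoint I z)).hasFDerivAt.isLittleO
    have h2 := h.comp_tendsto ((continuous_slicePoint I).tendsto z)
    refine (h2.trans_isBigO ?_).congr_left ?_
    · refine Asymptotics.IsBigO.of_bound 1 (Filter.Eventually.of_forall fun w => ?_)
      simp only [Function.comp_apply]
      rw [← slicePoint_sub hI, norm_slicePoint hI, one_mul]
    · intro w
      simp only [Function.comp_apply]
      rw [← slicePoint_sub hI, hf.fderiv_slicePoint hI, smul_def]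
  refine ⟨fun k => (((k.factorial : ℝ)⁻¹ : ℝ) : ℍ[ℝ]) *
    iteratedDeriv k (fun z => f (slicePoint I z)) 0, fun z => ?_⟩
  have h := Complex.hasSum_taylorSeries_of_entire hd 0 z
  convert h using 2 with k
  · rfl
  rw [sub_zero, smul_def, smul_def, ← Complex.ofReal_natCast, ← Complex.ofReal_inv,
    slicePoint_ofReal, slicePoint_pow hI, ← mul_assoc, ← mul_assoc, Quaternion.coe_commutes]

/-- On the real axis powers are real scalars, so these are ordinary vector-valued power series in a
real variable, whose coefficients are unique. -/
lemma coeff_unique {a b : ℕ → ℍ[ℝ]} {g : ℝ → ℍ[ℝ]}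
    (ha : ∀ x : ℝ, HasSum (fun k => (x : ℍ[ℝ]) ^ k * a k) (g x))
    (hb : ∀ x : ℝ, HasSum (fun k => (x : ℍ[ℝ]) ^ k * b k) (g x)) : a = b := by
  have key (c : ℕ → ℍ[ℝ]) (hc : ∀ x : ℝ, HasSum (fun k => (x : ℍ[ℝ]) ^ k * c k) (g x)) :
      HasFPowerSeriesAt g
        ((fun n => ContinuousMultilinearMap.mkPiRing ℝ (Fin n) (c n) :
          FormalMultilinearSeries ℝ ℝ ℍ[ℝ])) 0 := by
    refine hasFPowerSeriesAt_iff.2 ?_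
    refine Filter.Eventually.of_forall fun x => ?_
    rw [zero_add]
    convert hc x using 2 with k
    · rfl
    rw [← Quaternion.coe_pow, Quaternion.coe_mul_eq_smul]
    simp [FormalMultilinearSeries.coeff]
  have h := (key a ha).eq_formalMultilinearSeries (key b hb)
  funext n
  have h2 := congrArg (fun p : FormalMultilinearSeries ℝ ℝ ℍ[ℝ] => p.coeff n) h
  simpa [FormalMultilinearSeries.coeff] using h2

theorem SliceRegular.exists_hasPowerSeries {f : ℍ[ℝ] → ℍ[ℝ]} (hf : SliceRegular f) {I₀ : ℍ[ℝ]}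
    (hI₀ : I₀ ∈ imagSphere) : ∃ a, HasPowerSeries a f := by
  obtain ⟨a, ha⟩ := hf.exists_hasSum_slice hI₀
  refine ⟨a, fun q => ?_⟩
  obtain ⟨b, hb⟩ := hf.exists_hasSum_slice (imagUnit_mem hI₀ q)
  have hab : a = b := coeff_unique (g := fun x => f x)
    (fun x => by simpa only [slicePoint_ofReal] using ha x)
    (fun x => by simpa only [slicePoint_ofReal] using hb x)
  obtain ⟨z, hz⟩ := exists_slicePoint_imagUnit I₀ q
  have := hb z
  rw [← hz] at this
  rwa [hab]

lemma HasPowerSeries.sub {a b f g} (hf : HasPowerSeries a f) (hg : HasPowerSeries b g) :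
    HasPowerSeries (a - b) (f - g) := fun q => by
  simpa only [Pi.sub_apply, mul_sub] using (hf q).sub (hg q)

lemma hasPowerSeries_of_polynomial {a : ℕ → ℍ[ℝ]} {d : ℕ} {P : ℍ[ℝ] → ℍ[ℝ]}
    (h : ∀ q, P q = ∑ k ∈ Finset.range (d + 1), q ^ k * a k) :
    HasPowerSeries (fun k => if k ∈ Finset.range (d + 1) then a k else 0) P := fun q => by
  have := hasSum_sum_of_ne_finset_zero (f := fun k => q ^ k *
    (if k ∈ Finset.range (d + 1) then a k else 0)) (s := Finset.range (d + 1)) (L := .unconditional ℕ)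
    (fun k hk => by simp only [if_neg hk, mul_zero])
  rw [h q]
  convert this using 1
  exact Finset.sum_congr rfl fun k hk => by rw [if_pos hk]

lemma HasPowerSeries.summable_norm {a f} (hf : HasPowerSeries a f) (q : ℍ[ℝ]) :
    Summable fun k => ‖q‖ ^ k * ‖a k‖ := by
  simpa only [norm_mul, norm_pow] using (hf q).summable.norm

/-! ### The Fejér kernel as a cosine polynomial. -/

open Real MeasureTheory

/-- The cosine polynomial that agrees with `(sin (n t / 2) / sin (t / 2)) ^ 2` away from the zeros
of `sin (t / 2)`. -/
def fejerPoly (n : ℕ) (t : ℝ) : ℝ :=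
  ∑ k ∈ Finset.range n, 2 * ((n : ℝ) - k) * cos (k * t) - n

/-- The Dirichlet kernel; the `-1` corrects the term `k = 0`, which the sum counts twice. Summing
these kernels builds `fejerPoly`. -/
lemma dirichlet_mul_sin (n : ℕ) (t : ℝ) :
    (∑ k ∈ Finset.range (n + 1), 2 * cos (k * t) - 1) * sin (t / 2)
      = sin ((2 * n + 1) * t / 2) := by
  induction n with
  | zero => simp; ring
  | succ n ih =>
    have h1 : sin ((2 * ((n + 1 : ℕ) : ℝ) + 1) * t / 2)
        = sin (((n + 1 : ℕ) : ℝ) * t + t / 2) := by congr 1; ring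
    have h2 : sin ((2 * (n : ℝ) + 1) * t / 2)
        = sin (((n + 1 : ℕ) : ℝ) * t - t / 2) := by congr 1; push_cast; ring
    rw [Finset.sum_range_succ, h1]
    rw [h2, sin_sub] at ih
    rw [sin_add]
    linear_combination ih

lemma fejerPoly_succ (n : ℕ) (t : ℝ) :
    fejerPoly (n + 1) t = fejerPoly n t + (∑ k ∈ Finset.range (n + 1), 2 * cos (k * t) - 1) := by
  have h : ∑ k ∈ Finset.range n, 2 * ((n : ℝ) - k) * cos (k * t)
      = ∑ k ∈ Finset.range (n + 1), 2 * ((n : ℝ) - k) * cos (k * t) := by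
    rw [Finset.sum_range_succ]; simp
  have h2 : ∑ k ∈ Finset.range (n + 1), 2 * (((n + 1 : ℕ) : ℝ) - k) * cos (k * t)
      = ∑ k ∈ Finset.range (n + 1), 2 * ((n : ℝ) - k) * cos (k * t)
        + ∑ k ∈ Finset.range (n + 1), 2 * cos (k * t) := by
    rw [← Finset.sum_add_distrib]
    exact Finset.sum_congr rfl fun k _ => by push_cast; ring
  rw [fejerPoly, fejerPoly, h, h2]
  push_cast
  ring

/-- With `A = (2n+1)t/4` and `B = t/4`, the induction step is `sin² (A+B) - sin² (A-B) = sin 2A sin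
2B`. -/
lemma fejerPoly_mul_sin_sq (n : ℕ) (t : ℝ) :
    fejerPoly n t * sin (t / 2) ^ 2 = sin (n * t / 2) ^ 2 := by
  induction n with
  | zero => simp [fejerPoly]
  | succ n ih =>
    have h1 : sin (((n + 1 : ℕ) : ℝ) * t / 2)
        = sin ((2 * (n : ℝ) + 1) * t / 2 / 2 + t / 2 / 2) := by congr 1; push_cast; ring
    have h2 : sin ((n : ℝ) * t / 2) = sin ((2 * (n : ℝ) + 1) * t / 2 / 2 - t / 2 / 2) := by
      congr 1; ring
    have h3 : sin ((2 * (n : ℝ) + 1) * t / 2) =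
        2 * sin ((2 * (n : ℝ) + 1) * t / 2 / 2) * cos ((2 * (n : ℝ) + 1) * t / 2 / 2) := by
      rw [← sin_two_mul]; congr 1; ring
    have h4 : sin (t / 2) = 2 * sin (t / 2 / 2) * cos (t / 2 / 2) := by
      rw [← sin_two_mul]; congr 1; ring
    have h5 := dirichlet_mul_sin n t
    rw [fejerPoly_succ, add_mul, ih, h1, h2, pow_two (sin (t / 2)), ← mul_assoc, h5, h3, h4,
      sin_add, sin_sub]
    ring

lemma sin_half_ne_zero {t : ℝ} (ht : t ∈ Set.Ioc (-π) π) (h0 : t ≠ 0) : sin (t / 2) ≠ 0 := by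
  intro h
  have := (sin_eq_zero_iff_of_lt_of_lt (by linarith [ht.1, pi_pos]) (by linarith [ht.2, pi_pos])).1 h
  exact h0 (by linarith)

lemma fejerPoly_eq {t : ℝ} (ht : t ∈ Set.Ioc (-π) π) (h0 : t ≠ 0) (n : ℕ) :
    (sin (n * t / 2) / sin (t / 2)) ^ 2 = fejerPoly n t := by
  rw [div_pow, ← fejerPoly_mul_sin_sq, mul_div_assoc,
    div_self (pow_ne_zero 2 (sin_half_ne_zero ht h0)), mul_one]

/-- At `t = 0` the quotient of sines evaluates to `0`, while `fejerPoly n 0 = n²`; the mismatch is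
confined to a null set. -/
lemma ae_ne_zero : ∀ᵐ t : ℝ, t ≠ 0 := by
  simp [ae_iff, measure_singleton]

/-! ### Cosine polynomials and orthogonality. -/

/-- The even trigonometric polynomials of degree at most `d`. -/
def cosPolys (d : ℕ) : Submodule ℝ (ℝ → ℝ) :=
  Submodule.span ℝ {T | ∃ k ≤ d, T = fun t : ℝ => cos (k * t)}

lemma cos_mem_cosPolys {d k : ℕ} (h : k ≤ d) : (fun t : ℝ => cos (k * t)) ∈ cosPolys d :=
  Submodule.subset_span ⟨k, h, rfl⟩

lemma mul_mem_cosPolys {a b : ℕ} {S T : ℝ → ℝ} (hS : S ∈ cosPolys a) (hT : T ∈ cosPolys b) :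
    S * T ∈ cosPolys (a + b) := by
  have key : cosPolys a * cosPolys b ≤ cosPolys (a + b) := by
    clear hS hT S T
    rw [cosPolys, cosPolys, Submodule.span_mul_span, Submodule.span_le]
    rintro _ ⟨_, ⟨k, hk, rfl⟩, _, ⟨l, hl, rfl⟩, rfl⟩
    -- With `l ≤ k` the natural subtraction `k - l` in the product-to-sum formula is the true
    -- difference.
    wlog hkl : l ≤ k generalizing k l a b
    · have := this l hl k hk (by omega)
      rw [add_comm b a] at this
      convert this using 1
      exact mul_comm _ _
    have h : (fun t : ℝ => cos (k * t)) * (fun t : ℝ => cos (l * t))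
        = (1 / 2 : ℝ) • ((fun t : ℝ => cos ((k + l : ℕ) * t)) + fun t : ℝ => cos ((k - l : ℕ) * t)) := by
      funext t
      simp only [Pi.mul_apply, Pi.smul_apply, Pi.add_apply, smul_eq_mul]
      push_cast [Nat.cast_sub hkl]
      rw [add_mul, sub_mul, cos_add, cos_sub]
      ring
    change (fun t : ℝ => cos (k * t)) * (fun t : ℝ => cos (l * t)) ∈ cosPolys (a + b)
    rw [h]
    exact Submodule.smul_mem _ _ (add_mem (cos_mem_cosPolys (by omega)) (cos_mem_cosPolys (by omega)))
  exact key (Submodule.mul_mem_mul hS hT)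

lemma pow_mem_cosPolys {a : ℕ} {S : ℝ → ℝ} (hS : S ∈ cosPolys a) (r : ℕ) :
    S ^ r ∈ cosPolys (r * a) := by
  induction r with
  | zero =>
    have : (S ^ 0 : ℝ → ℝ) = fun t : ℝ => cos ((0 : ℕ) * t) := by funext t; simp
    rw [this]
    exact cos_mem_cosPolys (by omega)
  | succ r ih =>
    rw [pow_succ, add_mul, one_mul]
    exact mul_mem_cosPolys ih hS

lemma fejerPoly_mem_cosPolys (n : ℕ) (hn : 1 ≤ n) : fejerPoly n ∈ cosPolys (n - 1) := by
  have : fejerPoly n = ∑ k ∈ Finset.range n, (2 * ((n : ℝ) - k)) • (fun t : ℝ => cos (k * t))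
      - (n : ℝ) • fun t : ℝ => cos ((0 : ℕ) * t) := by
    funext t; simp [fejerPoly]
  rw [this]
  refine sub_mem (sum_mem fun k hk => Submodule.smul_mem _ _ (cos_mem_cosPolys ?_))
    (Submodule.smul_mem _ _ (cos_mem_cosPolys (by omega)))
  have := Finset.mem_range.1 hk
  omega

lemma continuous_of_mem_cosPolys {d : ℕ} {T : ℝ → ℝ} (hT : T ∈ cosPolys d) : Continuous T := by
  induction hT using Submodule.span_induction with
  | mem x h => obtain ⟨k, _, rfl⟩ := h; fun_prop
  | zero => exact continuous_zero
  | add x y _ _ hx hy => exact hx.add hy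
  | smul c x _ hx => exact hx.const_smul c

lemma even_of_mem_cosPolys {d : ℕ} {T : ℝ → ℝ} (hT : T ∈ cosPolys d) (t : ℝ) : T (-t) = T t := by
  induction hT using Submodule.span_induction with
  | mem x h => obtain ⟨k, _, rfl⟩ := h; simp
  | zero => rfl
  | add x y _ _ hx hy => simp [hx, hy]
  | smul c x _ hx => simp [hx]

lemma integral_cos_nat (n : ℕ) : ∫ t in (-π)..π, cos (n * t) = if n = 0 then 2 * π else 0 := by
  split_ifs with h
  · subst h; simp; ring
  · have hn : (n : ℝ) ≠ 0 := by exact_mod_cast h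
    rw [intervalIntegral.integral_comp_mul_left cos hn, integral_cos]; simp [sin_nat_mul_pi]

lemma integral_cos_mul_cos (j k : ℕ) : ∫ t in (-π)..π, cos (j * t) * cos (k * t) =
    if j = k then (if j = 0 then 2 * π else π) else 0 := by
  wlog hkj : k ≤ j generalizing j k
  · have := this k j (by omega)
    simp only [mul_comm (cos (k * _))] at this
    rw [this]
    by_cases h : j = k
    · subst h; rfl
    · rw [if_neg h, if_neg (Ne.symm h)]
  have h (t : ℝ) : cos (j * t) * cos (k * t)
      = (1 / 2 : ℝ) * (cos ((j + k : ℕ) * t) + cos ((j - k : ℕ) * t)) := by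
    push_cast [Nat.cast_sub hkj]
    rw [add_mul, sub_mul, cos_add, cos_sub]
    ring
  simp only [h]
  rw [intervalIntegral.integral_const_mul, intervalIntegral.integral_add
    (Continuous.intervalIntegrable (by fun_prop) _ _)
    (Continuous.intervalIntegrable (by fun_prop) _ _), integral_cos_nat, integral_cos_nat]
  by_cases hjk : j = k
  · subst hjk
    by_cases h0 : j = 0
    · simp [h0]; ring
    · simp [h0]
  · have h1 : j + k ≠ 0 := by omega
    have h2 : j - k ≠ 0 := by omega
    rw [if_neg h1, if_neg h2, if_neg hjk]
    simp

lemma integral_mul_cos_eq_zero {d : ℕ} {T : ℝ → ℝ} (hT : T ∈ cosPolys d) {j : ℕ} (hj : d < j) :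
    ∫ t in (-π)..π, T t * cos (j * t) = 0 := by
  induction hT using Submodule.span_induction with
  | mem x h =>
    obtain ⟨k, hk, rfl⟩ := h
    rw [integral_cos_mul_cos, if_neg (by omega)]
  | zero => simp
  | add x y hx' hy' hx hy =>
    have hxc := continuous_of_mem_cosPolys hx'
    have hyc := continuous_of_mem_cosPolys hy'
    simp only [Pi.add_apply, add_mul]
    rw [intervalIntegral.integral_add (Continuous.intervalIntegrable (by fun_prop) _ _)
      (Continuous.intervalIntegrable (by fun_prop) _ _), hx, hy, add_zero]
  | smul c x _ hx =>
    simp only [Pi.smul_apply, smul_eq_mul, mul_assoc]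
    rw [intervalIntegral.integral_const_mul, hx, mul_zero]

/-- The triangular weights of the Fejér kernel. The constant term of `fejerPoly` is `2n - n = n`,
half the pattern of the others, and this compensates for `∫ 1 = 2π` against `∫ cos² = π`. -/
lemma integral_fejerPoly_mul_cos {n j : ℕ} (hj : j ≤ n) :
    ∫ t in (-π)..π, fejerPoly n t * cos (j * t) = 2 * π * (n - j) := by
  have h (t : ℝ) : fejerPoly n t * cos (j * t) =
      ∑ k ∈ Finset.range n, 2 * ((n : ℝ) - k) * (cos (k * t) * cos (j * t))
        - n * (cos ((0 : ℕ) * t) * cos (j * t)) := by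
    rw [fejerPoly, sub_mul, Finset.sum_mul]
    simp [mul_assoc]
  simp only [h]
  rw [intervalIntegral.integral_sub (Continuous.intervalIntegrable (by fun_prop) _ _)
    (Continuous.intervalIntegrable (by fun_prop) _ _), intervalIntegral.integral_finsetSum
    (fun k _ => Continuous.intervalIntegrable (by fun_prop) _ _)]
  simp only [intervalIntegral.integral_const_mul, integral_cos_mul_cos]
  rcases Nat.eq_zero_or_pos j with rfl | hj0
  · rcases Nat.eq_zero_or_pos n with rfl | hn
    · simp
    · simp [Finset.sum_ite_eq', hn]
      ring
  · rcases hj.eq_or_lt with rfl | hjn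
    · rw [Finset.sum_eq_zero]
      · simp [hj0.ne]
      · intro k hk
        rw [if_neg (Finset.mem_range.1 hk).ne, mul_zero]
    · rw [Finset.sum_eq_single_of_mem j (Finset.mem_range.2 hjn)]
      · simp [hj0.ne, hj0.ne']
        ring
      · intro k _ hk
        rw [if_neg hk, mul_zero]

/-! ### Rotational averages of power series. -/

lemma HasPowerSeries.continuous {a f} (hf : HasPowerSeries a f) : Continuous f := by
  have : f = fun q => ∑' k, q ^ k * a k := funext fun q => (hf q).tsum_eq.symm
  rw [this, continuous_iff_continuousAt]
  intro q
  have h : ContinuousOn (fun q : ℍ[ℝ] => ∑' k, q ^ k * a k) (Metric.ball 0 (‖q‖ + 1)) := by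
    -- Weierstrass test: the series at the real point `‖q‖ + 1` majorizes on the whole ball.
    refine continuousOn_tsum (fun k => by fun_prop) (hf.summable_norm ((‖q‖ + 1 : ℝ) : ℍ[ℝ])) ?_
    intro k x hx
    rw [norm_mul, norm_pow, Quaternion.norm_coe, Real.norm_of_nonneg (by positivity)]
    have : ‖x‖ ≤ ‖q‖ + 1 := by simpa using (Metric.mem_ball.1 hx).le
    gcongr
  exact h.continuousAt (Metric.isOpen_ball.mem_nhds (by simp))

/-- The sine part is odd and integrates to zero. What remains is real, hence independent of `I` and
central in `ℍ`. -/
lemma integral_even_smul_expUnit {κ : ℝ → ℝ} (hκ : Continuous κ) (he : ∀ t, κ (-t) = κ t)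
    (I : ℍ[ℝ]) (j : ℕ) :
    ∫ t in (-π)..π, κ t • expUnit I (j * t)
      = ((∫ t in (-π)..π, κ t * cos (j * t) : ℝ) : ℍ[ℝ]) := by
  have hcos : Continuous fun t => κ t * cos (j * t) := by fun_prop
  have hsin : Continuous fun t => κ t * sin (j * t) := by fun_prop
  have hodd : ∫ t in (-π)..π, κ t * sin (j * t) = 0 := by
    have h := intervalIntegral.integral_comp_neg (a := -π) (b := π) (fun t => κ t * sin (j * t))
    simp only [he, mul_neg, sin_neg, neg_neg, intervalIntegral.integral_neg] at h
    linarith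
  have h (t : ℝ) : κ t • expUnit I (j * t)
      = (κ t * cos (j * t)) • (1 : ℍ[ℝ]) + (κ t * sin (j * t)) • I := by
    rw [expUnit, ← Quaternion.coe_commutes, Quaternion.coe_mul_eq_smul, smul_add,
      mul_smul (κ t), mul_smul (κ t), ← Quaternion.coe_mul_eq_smul (cos _), mul_one]
  simp only [h]
  rw [intervalIntegral.integral_add (Continuous.intervalIntegrable (by fun_prop) _ _)
    (Continuous.intervalIntegrable (by fun_prop) _ _), intervalIntegral.integral_smul_const,
    intervalIntegral.integral_smul_const, hodd, zero_smul, add_zero,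
    ← Quaternion.coe_mul_eq_smul, mul_one]

/-- Averaging rotations on a slice against an even kernel multiplies the power series coefficients
by the cosine coefficients of the kernel. -/
lemma HasPowerSeries.hasSum_integral_rotation {a f} (hf : HasPowerSeries a f) {κ : ℝ → ℝ}
    (hκ : Continuous κ) (he : ∀ t, κ (-t) = κ t) {I : ℍ[ℝ]} (hI : I ∈ imagSphere) (z : ℂ) (k : ℕ) :
    HasSum (fun j : ℕ => slicePoint I z ^ j *
        ((∫ t in (-π)..π, κ t * cos ((j * k : ℕ) * t)) • a j))
      (∫ t in (-π)..π, κ t • f (slicePoint I z * expUnit I (k * t))) := by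
  have hterm (j : ℕ) (t : ℝ) : κ t • ((slicePoint I z * expUnit I (k * t)) ^ j * a j)
      = slicePoint I z ^ j * ((κ t • expUnit I ((j * k : ℕ) * t)) * a j) := by
    have : (slicePoint I z * expUnit I (k * t)) ^ j
        = slicePoint I z ^ j * expUnit I ((j * k : ℕ) * t) := by
      rw [← slicePoint_exp, ← slicePoint_exp, ← slicePoint_mul hI, ← slicePoint_pow hI,
        ← slicePoint_pow hI, ← slicePoint_mul hI, mul_pow, ← Complex.exp_nat_mul]
      congr 3
      push_cast
      ring
    rw [this, smul_mul_assoc, mul_smul_comm, mul_assoc]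
  have hexp := continuous_expUnit I
  obtain ⟨M, hM⟩ := (isCompact_Icc (a := -π) (b := π)).exists_bound_of_continuousOn
    hκ.continuousOn
  -- Rotation preserves the norm, so the majorant does not depend on `t`.
  have h := intervalIntegral.hasSum_integral_of_dominated_convergence (a := -π) (b := π)
    (μ := volume)
    (F := fun (j : ℕ) t => κ t • ((slicePoint I z * expUnit I (k * t)) ^ j * a j))
    (f := fun t => κ t • f (slicePoint I z * expUnit I (k * t)))
    (fun (j : ℕ) _ => M * (‖slicePoint I z‖ ^ j * ‖a j‖))
    (fun j => Continuous.aestronglyMeasurable (by fun_prop))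
    (fun j => Filter.Eventually.of_forall fun t ht => ?_)
    (Filter.Eventually.of_forall fun t _ => (hf.summable_norm _).mul_left M)
    (by simp)
    (Filter.Eventually.of_forall fun t _ => (hf _).const_smul (κ t))
  · convert h using 2 with j
    · rfl
    simp only [hterm]
    have hL (c : ℝ → ℍ[ℝ]) (hc : Continuous c) :
        ∫ t in (-π)..π, slicePoint I z ^ j * (c t * a j)
          = slicePoint I z ^ j * ((∫ t in (-π)..π, c t) * a j) := by
      have h := ((ContinuousLinearMap.mul ℝ ℍ[ℝ] (slicePoint I z ^ j)).comp
        ((ContinuousLinearMap.mul ℝ ℍ[ℝ]).flip (a j))).intervalIntegral_comp_comm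
        (hc.intervalIntegrable (μ := volume) (-π) π)
      simpa using h
    rw [hL _ (by fun_prop), integral_even_smul_expUnit hκ he, Quaternion.coe_mul_eq_smul]
  · have ht' : t ∈ Set.Icc (-π) π := by
      rw [Set.uIoc_of_le (by linarith [pi_pos])] at ht
      exact Set.Ioc_subset_Icc_self ht
    rw [norm_smul, norm_mul, norm_pow, norm_mul, ← slicePoint_exp I, norm_slicePoint hI (Complex.exp _)]
    have : ‖Complex.exp (((k * t : ℝ) : ℂ) * Complex.I)‖ = 1 := Complex.norm_exp_ofReal_mul_I _
    rw [this, mul_one]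
    exact mul_le_mul_of_nonneg_right (hM t ht') (by positivity)

/-- Both sides sum the same series, which sees only the point and not the unit. This permits
replacing `I_q` by `I` even when `I_q = -I`, or when `q` is real and `I_q` is arbitrary. -/
lemma HasPowerSeries.integral_rotation_congr {a f} (hf : HasPowerSeries a f) {κ : ℝ → ℝ}
    (hκ : Continuous κ) (he : ∀ t, κ (-t) = κ t) {I J : ℍ[ℝ]} (hI : I ∈ imagSphere)
    (hJ : J ∈ imagSphere) {z w : ℂ} (h : slicePoint I z = slicePoint J w) (k : ℕ) :
    ∫ t in (-π)..π, κ t • f (slicePoint I z * expUnit I (k * t))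
      = ∫ t in (-π)..π, κ t • f (slicePoint J w * expUnit J (k * t)) := by
  have h1 := hf.hasSum_integral_rotation hκ he hI z k
  have h2 := hf.hasSum_integral_rotation hκ he hJ w k
  rw [h] at h1 ⊢
  exact h1.unique h2

lemma HasPowerSeries.integral_rotation_eq_sum {a f} (hf : HasPowerSeries a f) {d : ℕ} {κ : ℝ → ℝ}
    (hκ : κ ∈ cosPolys d) {I : ℍ[ℝ]} (hI : I ∈ imagSphere) (z : ℂ) {k : ℕ} (hk : 1 ≤ k) :
    ∫ t in (-π)..π, κ t • f (slicePoint I z * expUnit I (k * t))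
      = ∑ j ∈ Finset.range (d + 1), slicePoint I z ^ j *
        ((∫ t in (-π)..π, κ t * cos ((j * k : ℕ) * t)) • a j) := by
  refine (hf.hasSum_integral_rotation (continuous_of_mem_cosPolys hκ) (even_of_mem_cosPolys hκ)
    hI z k).unique (hasSum_sum_of_ne_finset_zero fun j hj => ?_)
  have hdj : d < j * k := by
    have : d < j := by simpa using hj
    nlinarith
  rw [integral_mul_cos_eq_zero hκ hdj, zero_smul, mul_zero]

/-! ### The three operators as coefficient multipliers. -/

lemma interval_integral_congr_kernel {E : Type*} [NormedAddCommGroup E] [NormedSpace ℝ E]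
    {κ κ' : ℝ → ℝ} (h : ∀ t ∈ Set.Ioc (-π) π, t ≠ 0 → κ t = κ' t) (g : ℝ → E) :
    ∫ t in (-π)..π, κ t • g t = ∫ t in (-π)..π, κ' t • g t := by
  refine intervalIntegral.integral_congr_ae ?_
  filter_upwards [ae_ne_zero] with t h0 ht
  rw [Set.uIoc_of_le (by linarith [pi_pos])] at ht
  rw [h t ht h0]

lemma fejerKernel_eq {t : ℝ} (ht : t ∈ Set.Ioc (-π) π) (h0 : t ≠ 0) (n : ℕ) :
    fejerKernel n t = ((1 / (2 * π * n)) • fejerPoly n) t := by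
  rw [fejerKernel, fejerPoly_eq ht h0]; rfl

lemma jacksonKernel_eq {t : ℝ} (ht : t ∈ Set.Ioc (-π) π) (h0 : t ≠ 0) (n r : ℕ) :
    jacksonKernel n r t = ((1 / jacksonConst n r) • fejerPoly n ^ r) t := by
  rw [jacksonKernel, pow_mul, fejerPoly_eq ht h0]; rfl

lemma fejer_mem_cosPolys {n : ℕ} (hn : 1 ≤ n) :
    (1 / (2 * π * n)) • fejerPoly n ∈ cosPolys (n - 1) :=
  Submodule.smul_mem _ _ (fejerPoly_mem_cosPolys n hn)

lemma jackson_mem_cosPolys {n : ℕ} (hn : 1 ≤ n) (r : ℕ) :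
    (1 / jacksonConst n r) • fejerPoly n ^ r ∈ cosPolys (r * (n - 1)) :=
  Submodule.smul_mem _ _ (pow_mem_cosPolys (fejerPoly_mem_cosPolys n hn) r)

lemma fejerOp_slicePoint {a f} (hf : HasPowerSeries a f) {I₀ I : ℍ[ℝ]} (hI₀ : I₀ ∈ imagSphere)
    (hI : I ∈ imagSphere) {n : ℕ} (hn : 1 ≤ n) (z : ℂ) :
    fejerOp I₀ n f (slicePoint I z)
      = ∫ t in (-π)..π, fejerKernel n t • f (slicePoint I z * expUnit I t) := by
  obtain ⟨w, hw⟩ := exists_slicePoint_imagUnit I₀ (slicePoint I z)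
  have h := fejer_mem_cosPolys hn
  have h2 := hf.integral_rotation_congr (continuous_of_mem_cosPolys h) (even_of_mem_cosPolys h)
    (imagUnit_mem hI₀ _) hI hw.symm 1
  rw [← hw] at h2
  simp only [Nat.cast_one, one_mul] at h2
  rw [fejerOp, interval_integral_congr_kernel fun t ht h0 => fejerKernel_eq ht h0 n, h2,
    interval_integral_congr_kernel fun t ht h0 => fejerKernel_eq ht h0 n]

lemma fejerOp_eq_sum {a f} (hf : HasPowerSeries a f) {I₀ : ℍ[ℝ]} (hI₀ : I₀ ∈ imagSphere)
    {n : ℕ} (hn : 1 ≤ n) (q : ℍ[ℝ]) :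
    fejerOp I₀ n f q = ∑ j ∈ Finset.range n, q ^ j * (((n - j : ℝ) / n) • a j) := by
  obtain ⟨w, hw⟩ := exists_slicePoint_imagUnit I₀ q
  have h2 := hf.integral_rotation_eq_sum (fejer_mem_cosPolys hn) (imagUnit_mem hI₀ q) w le_rfl
  rw [← hw] at h2
  simp only [Nat.cast_one, one_mul, mul_one, Nat.sub_add_cancel hn] at h2
  rw [fejerOp, interval_integral_congr_kernel fun t ht h0 => fejerKernel_eq ht h0 n, h2]
  refine Finset.sum_congr rfl fun j hj => ?_
  have hn0 : (n : ℝ) ≠ 0 := by positivity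
  simp only [Pi.smul_apply, smul_eq_mul, mul_assoc]
  rw [intervalIntegral.integral_const_mul, integral_fejerPoly_mul_cos (Finset.mem_range.1 hj).le]
  congr 2
  field_simp

/-- The multiplier is `2(2n-j)/(2n) - (n-j)/n = 1` for `j ≤ n`, after which only the first term
survives. -/
lemma valleePoussinOp_eq_sum {a f} (hf : HasPowerSeries a f) {I₀ : ℍ[ℝ]} (hI₀ : I₀ ∈ imagSphere)
    {n : ℕ} (hn : 1 ≤ n) (q : ℍ[ℝ]) :
    valleePoussinOp I₀ n f q = ∑ j ∈ Finset.range (2 * n), q ^ j *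
      ((if j ≤ n then 1 else (2 * n - j : ℝ) / n) • a j) := by
  have hn0 : (n : ℝ) ≠ 0 := by positivity
  have h1 : ∑ j ∈ Finset.range n, q ^ j * (((n - j : ℝ) / n) • a j)
      = ∑ j ∈ Finset.range (2 * n), q ^ j * ((if j ≤ n then (n - j : ℝ) / n else 0) • a j) := by
    rw [← Finset.sum_subset (Finset.range_subset_range.2 (by omega : n ≤ 2 * n))]
    · refine Finset.sum_congr rfl fun j hj => ?_
      rw [if_pos (Finset.mem_range.1 hj).le]
    · intro j _ hj
      have : n ≤ j := by simpa using hj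
      rcases this.eq_or_lt with rfl | h
      · simp
      · simp [h.not_ge]
  rw [valleePoussinOp, fejerOp_eq_sum hf hI₀ (by omega), fejerOp_eq_sum hf hI₀ hn, h1,
    Finset.smul_sum, ← Finset.sum_sub_distrib]
  refine Finset.sum_congr rfl fun j _ => ?_
  rw [← mul_smul_comm, ← mul_sub, smul_smul, ← sub_smul]
  congr 2
  push_cast
  split_ifs
  · field_simp; ring
  · field_simp; ring

lemma HasPowerSeries.integral_jackson_eq_sum {a f} (hf : HasPowerSeries a f) {n : ℕ} (hn : 1 ≤ n)
    (m r : ℕ) (q I : ℍ[ℝ]) :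
    ∫ t in (-π)..π, jacksonKernel n r t • ∑ k ∈ Finset.Icc 1 (m + 1),
        ((-1 : ℝ) ^ k * ((m + 1).choose k : ℝ)) • f (q * expUnit I (k * t))
      = ∑ k ∈ Finset.Icc 1 (m + 1), ((-1 : ℝ) ^ k * ((m + 1).choose k : ℝ)) •
        ∫ t in (-π)..π, ((1 / jacksonConst n r) • fejerPoly n ^ r) t • f (q * expUnit I (k * t)) := by
  have hκ := continuous_of_mem_cosPolys (jackson_mem_cosPolys hn r)
  have hfc := hf.continuous
  have hexp := continuous_expUnit I
  rw [interval_integral_congr_kernel fun t ht h0 => jacksonKernel_eq ht h0 n r]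
  generalize (1 / jacksonConst n r) • fejerPoly n ^ r = κ at hκ
  simp only [Finset.smul_sum]
  rw [intervalIntegral.integral_finsetSum
    (fun k _ => Continuous.intervalIntegrable (by fun_prop) _ _)]
  refine Finset.sum_congr rfl fun k _ => ?_
  rw [← intervalIntegral.integral_smul]
  exact intervalIntegral.integral_congr fun t _ => smul_comm _ _ _

lemma jacksonOp_slicePoint {a f} (hf : HasPowerSeries a f) {I₀ I : ℍ[ℝ]} (hI₀ : I₀ ∈ imagSphere)
    (hI : I ∈ imagSphere) {n : ℕ} (hn : 1 ≤ n) (m r : ℕ) (z : ℂ) :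
    jacksonOp I₀ n m r f (slicePoint I z)
      = -∫ t in (-π)..π, jacksonKernel n r t • ∑ k ∈ Finset.Icc 1 (m + 1),
        ((-1 : ℝ) ^ k * ((m + 1).choose k : ℝ)) • f (slicePoint I z * expUnit I (k * t)) := by
  have h := jackson_mem_cosPolys hn r
  obtain ⟨w, hw⟩ := exists_slicePoint_imagUnit I₀ (slicePoint I z)
  rw [jacksonOp, hf.integral_jackson_eq_sum hn, hf.integral_jackson_eq_sum hn]
  congr 1
  refine Finset.sum_congr rfl fun k _ => ?_
  have h2 := hf.integral_rotation_congr (continuous_of_mem_cosPolys h) (even_of_mem_cosPolys h)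
    (imagUnit_mem hI₀ _) hI hw.symm k
  rw [← hw] at h2
  rw [h2]

lemma jacksonOp_mem_polysDegreeLE {a f} (hf : HasPowerSeries a f) {I₀ : ℍ[ℝ]}
    (hI₀ : I₀ ∈ imagSphere) {n : ℕ} (hn : 1 ≤ n) (m r : ℕ) :
    jacksonOp I₀ n m r f ∈ polysDegreeLE (r * (n - 1)) := by
  refine ⟨fun j => -∑ k ∈ Finset.Icc 1 (m + 1), ((-1 : ℝ) ^ k * ((m + 1).choose k : ℝ)) •
    ((∫ t in (-π)..π, ((1 / jacksonConst n r) • fejerPoly n ^ r) t * cos ((j * k : ℕ) * t)) • a j),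
    fun q => ?_⟩
  obtain ⟨w, hw⟩ := exists_slicePoint_imagUnit I₀ q
  rw [jacksonOp, hf.integral_jackson_eq_sum hn]
  simp only [mul_neg, Finset.sum_neg_distrib, Finset.mul_sum]
  rw [Finset.sum_comm]
  congr 1
  refine Finset.sum_congr rfl fun k hk => ?_
  have h2 := hf.integral_rotation_eq_sum (jackson_mem_cosPolys hn r) (imagUnit_mem hI₀ q) w
    (Finset.mem_Icc.1 hk).1
  rw [← hw] at h2
  rw [h2, Finset.smul_sum]
  exact Finset.sum_congr rfl fun j _ => (mul_smul_comm _ _ _).symm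

/-! ### Weighted norms, rotations and averages. -/

/-- The Gaussian measure `(e^{-α |z|² / 2})^p dA(z)`. -/
def weightMeasure (α p : ℝ) : Measure ℂ :=
  volume.withDensity fun z => ENNReal.ofReal (exp (-α * ‖z‖ ^ 2 / 2)) ^ p

instance (α p : ℝ) : SFinite (weightMeasure α p) := by
  unfold weightMeasure; infer_instance

lemma measurable_weight (α p : ℝ) :
    Measurable fun z : ℂ => ENNReal.ofReal (exp (-α * ‖z‖ ^ 2 / 2)) ^ p := by
  fun_prop

lemma weightedIntegral_eq (α p : ℝ) {g : ℂ → ℍ[ℝ]} (hg : Continuous g) :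
    weightedIntegral α p g = ∫⁻ z, ‖g z‖ₑ ^ p ∂weightMeasure α p := by
  rw [weightMeasure, lintegral_withDensity_eq_lintegral_mul _ (measurable_weight α p)
    (hg.enorm.measurable.pow_const p)]
  simp only [weightedIntegral, Pi.mul_apply, mul_comm]

lemma weightedIntegral_rpow_eq {α p : ℝ} (hp : 0 < p) {g : ℂ → ℍ[ℝ]} (hg : Continuous g) :
    weightedIntegral α p g ^ (1 / p) = eLpNorm g (ENNReal.ofReal p) (weightMeasure α p) := by
  rw [weightedIntegral_eq α p hg, eLpNorm_eq_lintegral_rpow_enorm_toReal (by simpa using hp) (by simp),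
    ENNReal.toReal_ofReal hp.le]

lemma weightedIntegral_eq_eLpNorm_rpow {α p : ℝ} (hp : 0 < p) {g : ℂ → ℍ[ℝ]} (hg : Continuous g) :
    weightedIntegral α p g = eLpNorm g (ENNReal.ofReal p) (weightMeasure α p) ^ p := by
  rw [← weightedIntegral_rpow_eq hp hg, ← ENNReal.rpow_mul, one_div, inv_mul_cancel₀ hp.ne',
    ENNReal.rpow_one]

/-- The operator `u ↦ u(e^{i t} ·)`. -/
def rotate (t : ℝ) : Module.End ℝ (ℂ → ℍ[ℝ]) :=
  LinearMap.funLeft ℝ ℍ[ℝ] fun z => z * Complex.exp (t * Complex.I)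

lemma rotate_apply (t : ℝ) (u : ℂ → ℍ[ℝ]) (z : ℂ) :
    rotate t u z = u (z * Complex.exp (t * Complex.I)) := rfl

lemma rotate_pow (t : ℝ) (j : ℕ) : rotate t ^ j = rotate (j * t) := by
  induction j with
  | zero => ext u z : 2; simp [rotate_apply]
  | succ j ih =>
    rw [pow_succ, ih]
    refine LinearMap.ext fun u => funext fun z => ?_
    simp only [Module.End.mul_apply, rotate_apply]
    rw [mul_assoc, ← Complex.exp_add]
    congr 3
    push_cast; ring

lemma continuous_rotate (t : ℝ) {u : ℂ → ℍ[ℝ]} (hu : Continuous u) : Continuous (rotate t u) := by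
  unfold rotate; exact hu.comp (by fun_prop)

lemma weightedIntegral_rotate (α p t : ℝ) {u : ℂ → ℍ[ℝ]} :
    weightedIntegral α p (rotate t u) = weightedIntegral α p u := by
  have h := (rotation (Circle.exp t)).measurePreserving.lintegral_comp_emb
    (rotation (Circle.exp t)).toHomeomorph.measurableEmbedding
    (fun z : ℂ => ‖u z‖ₑ ^ p * ENNReal.ofReal (exp (-α * ‖z‖ ^ 2 / 2)) ^ p)
  unfold weightedIntegral
  rw [← h]
  refine lintegral_congr fun z => ?_
  rw [LinearIsometryEquiv.norm_map, rotation_apply, Circle.coe_exp, mul_comm _ z, rotate_apply]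

lemma eLpNorm_rotate {α p : ℝ} (hp : 0 < p) (t : ℝ) {u : ℂ → ℍ[ℝ]} (hu : Continuous u) :
    eLpNorm (rotate t u) (ENNReal.ofReal p) (weightMeasure α p)
      = eLpNorm u (ENNReal.ofReal p) (weightMeasure α p) := by
  rw [← weightedIntegral_rpow_eq hp hu, ← weightedIntegral_rpow_eq hp (continuous_rotate t hu),
    weightedIntegral_rotate]

lemma continuous_geom_sum_rotate (t : ℝ) (j : ℕ) {u : ℂ → ℍ[ℝ]} (hu : Continuous u) :
    Continuous ((∑ i ∈ Finset.range j, rotate t ^ i) u) := by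
  rw [LinearMap.sum_apply]
  have : ∀ i, Continuous ((rotate t ^ i) u) := fun i => by
    rw [rotate_pow]; exact continuous_rotate _ hu
  rw [Finset.sum_fn]
  exact continuous_finsetSum _ fun i _ => this i

lemma eLpNorm_geom_sum_rotate_le {α p : ℝ} (hp : 1 ≤ p) (t : ℝ) (j : ℕ) {u : ℂ → ℍ[ℝ]}
    (hu : Continuous u) :
    eLpNorm ((∑ i ∈ Finset.range j, rotate t ^ i) u) (ENNReal.ofReal p) (weightMeasure α p)
      ≤ j * eLpNorm u (ENNReal.ofReal p) (weightMeasure α p) := by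
  rw [LinearMap.sum_apply]
  refine (eLpNorm_sum_le (fun i _ => ?_) (by simpa using hp)).trans ?_
  · rw [rotate_pow]; exact (continuous_rotate _ hu).aestronglyMeasurable
  · simp only [rotate_pow, eLpNorm_rotate (by linarith : 0 < p) _ hu]
    simp

lemma eLpNorm_geom_sum_rotate_pow_le {α p : ℝ} (hp : 1 ≤ p) (t : ℝ) (j k : ℕ) {u : ℂ → ℍ[ℝ]}
    (hu : Continuous u) :
    eLpNorm (((∑ i ∈ Finset.range j, rotate t ^ i) ^ k) u) (ENNReal.ofReal p) (weightMeasure α p)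
      ≤ j ^ k * eLpNorm u (ENNReal.ofReal p) (weightMeasure α p) := by
  induction k generalizing u with
  | zero => simp
  | succ k ih =>
    rw [pow_succ, Module.End.mul_apply]
    refine (ih (continuous_geom_sum_rotate t j hu)).trans ?_
    rw [pow_succ, mul_assoc]
    gcongr
    exact eLpNorm_geom_sum_rotate_le hp t j hu

lemma continuous_rotate_sub_one_pow (t : ℝ) (k : ℕ) {u : ℂ → ℍ[ℝ]} (hu : Continuous u) :
    Continuous (((rotate t - 1) ^ k) u) := by
  induction k generalizing u with
  | zero => simpa using hu
  | succ k ih =>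
    rw [pow_succ, Module.End.mul_apply]
    exact ih ((continuous_rotate t hu).sub hu)

/-- With `T = rotate t`, `T^j - 1 = (1 + T + ⋯ + T^{j-1})(T - 1)`. The factors commute and `T` is
isometric, so the `k`-th power of the geometric sum costs at most `j^k`. -/
lemma eLpNorm_rotate_nat_mul_sub_one_pow_le {α p : ℝ} (hp : 1 ≤ p) (t : ℝ) (j k : ℕ)
    {u : ℂ → ℍ[ℝ]} (hu : Continuous u) :
    eLpNorm (((rotate (j * t) - 1) ^ k) u) (ENNReal.ofReal p) (weightMeasure α p)
      ≤ j ^ k * eLpNorm (((rotate t - 1) ^ k) u) (ENNReal.ofReal p) (weightMeasure α p) := by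
  have hc : Commute (∑ i ∈ Finset.range j, rotate t ^ i) (rotate t - 1) := by
    refine Commute.sum_left _ _ _ fun i _ => ?_
    exact ((Commute.refl _).pow_left i).sub_right (Commute.one_right _)
  rw [← rotate_pow, ← geom_sum_mul, hc.mul_pow, Module.End.mul_apply]
  exact eLpNorm_geom_sum_rotate_pow_le hp t j k (continuous_rotate_sub_one_pow t k hu)

/-- The binomial theorem for the commuting operators `rotate h` and `-1`. -/
lemma rotDiff_slicePoint {I : ℍ[ℝ]} (hI : I ∈ imagSphere) (k : ℕ) (h : ℝ) (f : ℍ[ℝ] → ℍ[ℝ]) :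
    (fun z => rotDiff I k h f (slicePoint I z))
      = ((rotate h - 1) ^ k) fun z => f (slicePoint I z) := by
  rw [sub_eq_add_neg, ((Commute.one_right (rotate h)).neg_right).add_pow]
  funext z
  simp only [rotDiff, LinearMap.sum_apply, Finset.sum_apply]
  refine Finset.sum_congr rfl fun s hs => ?_
  have hs' : s ≤ k := by simpa [Nat.lt_succ_iff] using hs
  have h1 : (-1 : ℝ) ^ (k + s) = (-1) ^ (k - s) := by
    have : k + s = (k - s) + 2 * s := by omega
    rw [this, pow_add, pow_mul]; simp
  have h2 : rotate h ^ s * (-1) ^ (k - s) * ((k.choose s : ℕ) : Module.End ℝ (ℂ → ℍ[ℝ]))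
      = ((-1 : ℝ) ^ (k + s) * (k.choose s : ℝ)) • rotate (s * h) := by
    rw [h1, ← rotate_pow]
    have hx : (-1 : Module.End ℝ (ℂ → ℍ[ℝ])) ^ (k - s) * ((k.choose s : ℕ) : Module.End ℝ _)
        = algebraMap ℝ _ ((-1) ^ (k - s) * (k.choose s : ℝ)) := by simp
    rw [mul_assoc, hx, Algebra.smul_def, Algebra.commutes]
  rw [h2, LinearMap.smul_apply, Pi.smul_apply, rotate_apply, slicePoint_mul_expUnit hI]

/-- Jensen's inequality for averages against a kernel of mass at most one, integrated in `z`. -/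
lemma weightedIntegral_average_le {α p : ℝ} (hp : 1 ≤ p) {κ : ℝ → ℝ} (hκ : Measurable κ)
    (h0 : ∀ t, 0 ≤ κ t) (h1 : ∫⁻ t in Set.Ioc (-π) π, ENNReal.ofReal (κ t) = 1)
    {G : ℝ → ℂ → ℍ[ℝ]} (hG : Continuous (Function.uncurry G)) :
    weightedIntegral α p (fun z => ∫ t in (-π)..π, κ t • G t z)
      ≤ ∫⁻ t in Set.Ioc (-π) π, ENNReal.ofReal (κ t) * weightedIntegral α p (G t) := by
  have hGz (z : ℂ) : Continuous fun t => G t z := hG.comp (by fun_prop : Continuous fun t => (t, z))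
  have hGt (t : ℝ) : Continuous (G t) := hG.comp (by fun_prop : Continuous fun z => (t, z))
  set ν := (volume.restrict (Set.Ioc (-π) π)).withDensity fun t => ENNReal.ofReal (κ t) with hν
  have hprob : IsProbabilityMeasure ν := ⟨by rw [hν, withDensity_apply _ MeasurableSet.univ]; simpa⟩
  have hden : Measurable fun t => ENNReal.ofReal (κ t) := by fun_prop
  have hpt (z : ℂ) : ‖∫ t in (-π)..π, κ t • G t z‖ₑ ^ p ≤
      ∫⁻ t in Set.Ioc (-π) π, ENNReal.ofReal (κ t) * ‖G t z‖ₑ ^ p := by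
    have e1 : ‖∫ t in (-π)..π, κ t • G t z‖ₑ ≤ ∫⁻ t, ‖G t z‖ₑ ∂ν := by
      rw [intervalIntegral.integral_of_le (by linarith [pi_pos])]
      refine (enorm_integral_le_lintegral_enorm _).trans ?_
      rw [hν, lintegral_withDensity_eq_lintegral_mul _ hden (hGz z).enorm.measurable]
      refine lintegral_mono fun t => ?_
      simp only [Pi.mul_apply, enorm_smul, Real.enorm_of_nonneg (h0 t)]
      exact le_rfl
    -- Jensen's inequality, as the comparison of `L^1` and `L^p` norms for the probability measure
    -- `ν`.
    have e2 : ∫⁻ t, ‖G t z‖ₑ ∂ν ≤ (∫⁻ t, ‖G t z‖ₑ ^ p ∂ν) ^ (1 / p) := by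
      have := eLpNorm_le_eLpNorm_of_exponent_le (μ := ν) (p := 1) (q := ENNReal.ofReal p)
        (by simpa using hp) (hGz z).aestronglyMeasurable
      rwa [eLpNorm_one_eq_lintegral_enorm, eLpNorm_eq_lintegral_rpow_enorm_toReal
        (by simp; linarith) (by simp), ENNReal.toReal_ofReal (by linarith)] at this
    calc _ ≤ ((∫⁻ t, ‖G t z‖ₑ ^ p ∂ν) ^ (1 / p)) ^ p :=
          ENNReal.rpow_le_rpow (e1.trans e2) (by linarith)
      _ = ∫⁻ t, ‖G t z‖ₑ ^ p ∂ν := by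
          rw [← ENNReal.rpow_mul, one_div, inv_mul_cancel₀ (by linarith), ENNReal.rpow_one]
      _ = _ := by
          have := hGz z
          rw [hν, lintegral_withDensity_eq_lintegral_mul _ hden (this.enorm.measurable.pow_const p)]
          rfl
  have hw := measurable_weight α p
  unfold weightedIntegral
  calc _ ≤ ∫⁻ z : ℂ, ∫⁻ t in Set.Ioc (-π) π, ENNReal.ofReal (κ t) * (‖G t z‖ₑ ^ p *
          ENNReal.ofReal (exp (-α * ‖z‖ ^ 2 / 2)) ^ p) := by
        refine lintegral_mono fun z => ?_
        have hm : Measurable fun t => ENNReal.ofReal (κ t) * ‖G t z‖ₑ ^ p :=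
          hden.mul ((hGz z).enorm.measurable.pow_const p)
        simp only [← mul_assoc]
        rw [lintegral_mul_const _ hm]
        exact mul_le_mul_left (hpt z) _
    _ = ∫⁻ t in Set.Ioc (-π) π, ∫⁻ z : ℂ, ENNReal.ofReal (κ t) * (‖G t z‖ₑ ^ p *
          ENNReal.ofReal (exp (-α * ‖z‖ ^ 2 / 2)) ^ p) := by
        refine lintegral_lintegral_swap (Measurable.aemeasurable ?_)
        have : Continuous fun x : ℂ × ℝ => G x.2 x.1 := hG.comp continuous_swap
        exact (hden.comp measurable_snd).mul
          ((this.enorm.measurable.pow_const p).mul (hw.comp measurable_fst))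
    _ = _ := by
        refine lintegral_congr fun t => ?_
        have hm : Measurable fun z => ‖G t z‖ₑ ^ p *
            ENNReal.ofReal (exp (-α * ‖z‖ ^ 2 / 2)) ^ p :=
          ((hGt t).enorm.measurable.pow_const p).mul hw
        rw [lintegral_const_mul _ hm]

/-! ### Size and moments of the Jackson kernel. -/

lemma abs_sin_nat_mul_le (n : ℕ) (x : ℝ) : |sin (n * x)| ≤ n * |sin x| := by
  induction n with
  | zero => simp
  | succ n ih =>
    push_cast
    rw [add_mul, one_mul, sin_add, add_mul, one_mul]
    refine (abs_add_le _ _).trans (add_le_add ?_ ?_)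
    · rw [abs_mul]
      exact (mul_le_of_le_one_right (abs_nonneg _) (abs_cos_le_one x)).trans ih
    · rw [abs_mul]
      exact mul_le_of_le_one_left (abs_nonneg _) (abs_cos_le_one _)

/-- Combines the two bounds `n` and `π/|t|` for the ratio: the first controls the summand `1`, the
second the summand `n|t|`. -/
lemma jacksonRatio_mul_le {t : ℝ} (ht : t ∈ Set.Ioc (-π) π) (h0 : t ≠ 0) (n : ℕ) :
    |sin (n * t / 2) / sin (t / 2)| * (1 + n * |t|) ≤ (π + 1) * n := by
  have hs : 0 < |sin (t / 2)| := abs_pos.2 (sin_half_ne_zero ht h0)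
  have habs : |t| ≤ π := abs_le.2 ⟨ht.1.le, ht.2⟩
  have h1 : |t| / π ≤ |sin (t / 2)| := by
    have h := mul_abs_le_abs_sin (x := t / 2) (by rw [abs_div, abs_two]; linarith)
    rw [abs_div, abs_two] at h
    calc |t| / π = 2 / π * (|t| / 2) := by ring
      _ ≤ _ := h
  have h2 : |sin (n * t / 2)| ≤ n * |sin (t / 2)| := by
    have h := abs_sin_nat_mul_le n (t / 2)
    rwa [← mul_div_assoc] at h
  rw [abs_div, div_mul_eq_mul_div, div_le_iff₀ hs]
  have h3 : |t| ≤ |sin (t / 2)| * π := (div_le_iff₀ pi_pos).1 h1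
  calc |sin (n * t / 2)| * (1 + n * |t|) = |sin (n * t / 2)| + n * (|sin (n * t / 2)| * |t|) := by ring
    _ ≤ n * |sin (t / 2)| + n * (1 * (|sin (t / 2)| * π)) := by
        gcongr
        exact abs_sin_le_one _
    _ = _ := by ring

/-- Jordan's inequality bounds the numerator below, and `sin x ≤ x` bounds the denominator above. -/
lemma le_jacksonRatio {n : ℕ} (hn : 1 ≤ n) {t : ℝ} (h0 : 0 < t) (ht : t ≤ π / n) :
    2 * n / π ≤ sin (n * t / 2) / sin (t / 2) := by
  have hn0 : (1 : ℝ) ≤ n := by exact_mod_cast hn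
  have hnt : n * t ≤ π := by rwa [mul_comm, ← le_div_iff₀ (by linarith)]
  have htp : t ≤ π := by nlinarith
  have hs : 0 < sin (t / 2) := sin_pos_of_pos_of_lt_pi (by linarith) (by linarith [pi_pos])
  rw [le_div_iff₀ hs]
  have h1 := mul_le_sin (x := n * t / 2) (by positivity) (by linarith)
  have h2 : sin (t / 2) ≤ t / 2 := sin_le (by linarith)
  calc 2 * n / π * sin (t / 2) ≤ 2 * n / π * (t / 2) := by gcongr
    _ = 2 / π * (n * t / 2) := by ring
    _ ≤ _ := h1

lemma jacksonConst_eq (n r : ℕ) : jacksonConst n r = ∫ t in (-π)..π, fejerPoly n t ^ r := by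
  refine intervalIntegral.integral_congr_ae ?_
  filter_upwards [ae_ne_zero] with t h0 ht
  rw [Set.uIoc_of_le (by linarith [pi_pos])] at ht
  rw [pow_mul, fejerPoly_eq ht h0]

lemma continuous_fejerPoly (n : ℕ) : Continuous (fejerPoly n) := by
  unfold fejerPoly; fun_prop

lemma fejerPoly_nonneg {t : ℝ} (ht : t ∈ Set.Ioc (-π) π) (h0 : t ≠ 0) (n : ℕ) :
    0 ≤ fejerPoly n t := by
  rw [← fejerPoly_eq ht h0]; positivity

lemma le_jacksonConst {n : ℕ} (hn : 1 ≤ n) (r : ℕ) :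
    (2 * n / π) ^ (2 * r) * (π / n) ≤ jacksonConst n r := by
  have hn0 : (1 : ℝ) ≤ n := by exact_mod_cast hn
  have hpn : 0 < π / n := by positivity
  have hpn' : π / n ≤ π := div_le_self pi_pos.le hn0
  have hc := continuous_fejerPoly n
  rw [jacksonConst_eq]
  calc (2 * n / π) ^ (2 * r) * (π / n) = ∫ t in (0 : ℝ)..(π / n), (2 * n / π) ^ (2 * r) := by
        simp [mul_comm]
    _ ≤ ∫ t in (0 : ℝ)..(π / n), fejerPoly n t ^ r := by
        refine intervalIntegral.integral_mono_on_of_le_Ioo hpn.le (by simp)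
          (Continuous.intervalIntegrable (by fun_prop) _ _) fun t ht => ?_
        rw [← fejerPoly_eq ⟨by linarith [ht.1, pi_pos], by linarith [ht.2]⟩ ht.1.ne', ← pow_mul]
        exact pow_le_pow_left₀ (by positivity) (le_jacksonRatio hn ht.1 ht.2.le) _
    _ ≤ _ := by
        refine intervalIntegral.integral_mono_interval (by linarith [pi_pos]) hpn.le hpn' ?_
          (Continuous.intervalIntegrable (by fun_prop) _ _)
        filter_upwards [ae_restrict_mem measurableSet_Ioc, ae_restrict_of_ae ae_ne_zero] with t ht h0
        exact pow_nonneg (fejerPoly_nonneg ht h0 n) r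

lemma jacksonConst_pos {n : ℕ} (hn : 1 ≤ n) (r : ℕ) : 0 < jacksonConst n r := by
  have hn0 : (1 : ℝ) ≤ n := by exact_mod_cast hn
  exact lt_of_lt_of_le (by positivity) (le_jacksonConst hn r)

lemma jacksonKernel_nonneg {n : ℕ} (hn : 1 ≤ n) (r : ℕ) (t : ℝ) : 0 ≤ jacksonKernel n r t := by
  have := jacksonConst_pos hn r
  rw [jacksonKernel, pow_mul]
  positivity

lemma fejerKernel_nonneg (n : ℕ) (t : ℝ) : 0 ≤ fejerKernel n t := by
  have := pi_pos
  rw [fejerKernel]; positivity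

lemma measurable_jacksonKernel (n r : ℕ) : Measurable (jacksonKernel n r) := by
  unfold jacksonKernel; fun_prop

lemma measurable_fejerKernel (n : ℕ) : Measurable (fejerKernel n) := by
  unfold fejerKernel; fun_prop

lemma lintegral_kernel_eq_one {κ κ' : ℝ → ℝ} (h0 : ∀ t, 0 ≤ κ t) (hκ' : Continuous κ')
    (h : ∀ t ∈ Set.Ioc (-π) π, t ≠ 0 → κ t = κ' t) (h1 : ∫ t in (-π)..π, κ' t = 1) :
    ∫⁻ t in Set.Ioc (-π) π, ENNReal.ofReal (κ t) = 1 := by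
  have hae : κ =ᵐ[volume.restrict (Set.Ioc (-π) π)] κ' := by
    filter_upwards [ae_restrict_mem measurableSet_Ioc, ae_restrict_of_ae ae_ne_zero] with t ht h0
    exact h t ht h0
  rw [lintegral_congr_ae (g := fun t => ENNReal.ofReal (κ' t))
    (hae.mono fun t ht => congrArg ENNReal.ofReal ht),
    ← ofReal_integral_eq_lintegral_ofReal, ← intervalIntegral.integral_of_le (by linarith [pi_pos]),
    h1, ENNReal.ofReal_one]
  · exact ((hκ'.intervalIntegrable (-π) π).1)
  · filter_upwards [hae] with t ht
    simpa [← ht] using h0 t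

lemma lintegral_jacksonKernel {n : ℕ} (hn : 1 ≤ n) (r : ℕ) :
    ∫⁻ t in Set.Ioc (-π) π, ENNReal.ofReal (jacksonKernel n r t) = 1 := by
  refine lintegral_kernel_eq_one (jacksonKernel_nonneg hn r)
    (continuous_of_mem_cosPolys (jackson_mem_cosPolys hn r))
    (fun t ht h0 => jacksonKernel_eq ht h0 n r) ?_
  simp only [Pi.smul_apply, Pi.pow_apply, smul_eq_mul]
  rw [intervalIntegral.integral_const_mul, ← jacksonConst_eq, one_div,
    inv_mul_cancel₀ (jacksonConst_pos hn r).ne']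

lemma lintegral_fejerKernel {n : ℕ} (hn : 1 ≤ n) :
    ∫⁻ t in Set.Ioc (-π) π, ENNReal.ofReal (fejerKernel n t) = 1 := by
  refine lintegral_kernel_eq_one (fejerKernel_nonneg n)
    (continuous_of_mem_cosPolys (fejer_mem_cosPolys hn))
    (fun t ht h0 => fejerKernel_eq ht h0 n) ?_
  have h := integral_fejerPoly_mul_cos (n := n) (Nat.zero_le _)
  simp only [Nat.cast_zero, zero_mul, cos_zero, mul_one, sub_zero] at h
  have hn0 : (n : ℝ) ≠ 0 := by positivity
  simp only [Pi.smul_apply, smul_eq_mul]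
  rw [intervalIntegral.integral_const_mul, h]
  field_simp

/-- The factor `(1 + n|t|)^{2r}` is absorbed by the kernel. Since `s ≤ 2r - 2`, at least two powers
remain to spare and give an integrable majorant. -/
lemma jacksonKernel_mul_le {n : ℕ} (hn : 1 ≤ n) {r : ℕ} {s : ℝ} (hs : s + 2 ≤ 2 * r) {t : ℝ}
    (ht : t ∈ Set.Ioc (-π) π) (h0 : t ≠ 0) :
    jacksonKernel n r t * (1 + n * |t|) ^ s ≤
      ((π + 1) * π / 2) ^ (2 * r) * (n / π) * (1 + (n * t) ^ 2)⁻¹ := by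
  have hn0 : (1 : ℝ) ≤ n := by exact_mod_cast hn
  set w := 1 + n * |t| with hw
  have hw1 : 1 ≤ w := by rw [hw]; nlinarith [abs_nonneg t]
  have hw0 : 0 < w := by linarith
  have hr : jacksonKernel n r t = |sin (n * t / 2) / sin (t / 2)| ^ (2 * r) / jacksonConst n r := by
    rw [jacksonKernel, (even_two_mul r).pow_abs]; ring
  set ρ := |sin (n * t / 2) / sin (t / 2)| with hρ
  have hρ0 : 0 ≤ ρ := abs_nonneg _
  have h1 : w ^ s ≤ w ^ (2 * r) * (w ^ 2)⁻¹ := by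
    rw [← div_eq_mul_inv, le_div_iff₀ (by positivity), ← rpow_natCast w 2, ← rpow_add hw0,
      ← rpow_natCast w (2 * r)]
    exact rpow_le_rpow_of_exponent_le hw1 (by push_cast; linarith)
  have h2 : (w ^ 2)⁻¹ ≤ (1 + (n * t) ^ 2)⁻¹ := by
    refine inv_anti₀ (by positivity) ?_
    have : (n * t) ^ 2 = (n * |t|) ^ 2 := by rw [mul_pow, mul_pow, sq_abs]
    rw [this, hw]
    nlinarith [abs_nonneg t, mul_nonneg (by linarith : (0 : ℝ) ≤ n) (abs_nonneg t)]
  have h3 : (ρ * w) ^ (2 * r) ≤ ((π + 1) * n) ^ (2 * r) :=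
    pow_le_pow_left₀ (by positivity) (jacksonRatio_mul_le ht h0 n) _
  have hpos := jacksonConst_pos hn r
  rw [hr, div_mul_eq_mul_div, div_le_iff₀ hpos]
  calc ρ ^ (2 * r) * w ^ s ≤ ρ ^ (2 * r) * (w ^ (2 * r) * (w ^ 2)⁻¹) := by gcongr
    _ = (ρ * w) ^ (2 * r) * (w ^ 2)⁻¹ := by rw [mul_pow]; ring
    _ ≤ ((π + 1) * n) ^ (2 * r) * (1 + (n * t) ^ 2)⁻¹ := by gcongr
    _ = ((π + 1) * π / 2) ^ (2 * r) * (n / π) * (1 + (n * t) ^ 2)⁻¹ *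
          ((2 * n / π) ^ (2 * r) * (π / n)) := by
        -- Dividing by the lower bound for `jacksonConst` cancels `n^{2r}`, leaving only the factor
        -- `n / π` that normalizes the Cauchy-type majorant.
        have e : (π + 1) * n = ((π + 1) * π / 2) * (2 * n / π) := by field_simp
        rw [e, mul_pow]
        field_simp
    _ ≤ _ := by
        gcongr
        exact le_jacksonConst hn r

lemma lintegral_jacksonKernel_mul_le {n : ℕ} (hn : 1 ≤ n) {r : ℕ} {s : ℝ} (hs : s + 2 ≤ 2 * r) :
    ∫⁻ t in Set.Ioc (-π) π, ENNReal.ofReal (jacksonKernel n r t) *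
      ENNReal.ofReal ((1 + n * |t|) ^ s) ≤ ENNReal.ofReal (((π + 1) * π / 2) ^ (2 * r)) := by
  have hn0 : (1 : ℝ) ≤ n := by exact_mod_cast hn
  have hc : Continuous fun t : ℝ => ((π + 1) * π / 2) ^ (2 * r) * (n / π) * (1 + (n * t) ^ 2)⁻¹ := by
    refine continuous_const.mul (Continuous.inv₀ (by fun_prop) fun t => by positivity)
  calc _ ≤ ∫⁻ t in Set.Ioc (-π) π, ENNReal.ofReal
        (((π + 1) * π / 2) ^ (2 * r) * (n / π) * (1 + (n * t) ^ 2)⁻¹) := by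
        refine lintegral_mono_ae ?_
        filter_upwards [ae_restrict_mem measurableSet_Ioc, ae_restrict_of_ae ae_ne_zero] with t ht h0
        rw [← ENNReal.ofReal_mul (jacksonKernel_nonneg hn r t)]
        exact ENNReal.ofReal_le_ofReal (jacksonKernel_mul_le hn hs ht h0)
    _ = ENNReal.ofReal (∫ t in (-π)..π,
        ((π + 1) * π / 2) ^ (2 * r) * (n / π) * (1 + (n * t) ^ 2)⁻¹) := by
        rw [intervalIntegral.integral_of_le (by linarith [pi_pos]),
          ofReal_integral_eq_lintegral_ofReal (hc.intervalIntegrable (-π) π).1]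
        exact Filter.Eventually.of_forall fun t => by simp only [Pi.zero_apply]; positivity
    _ ≤ _ := by
        refine ENNReal.ofReal_le_ofReal ?_
        rw [intervalIntegral.integral_const_mul,
          intervalIntegral.integral_comp_mul_left (fun x => (1 + x ^ 2)⁻¹) (by linarith : (n : ℝ) ≠ 0),
          integral_inv_one_add_sq, smul_eq_mul]
        -- The arctangent increment is less than `π`, so the bound is uniform in `n`.
        have h1 := arctan_lt_pi_div_two (n * π)
        have h2 := neg_pi_div_two_lt_arctan (n * -π)
        calc _ ≤ ((π + 1) * π / 2) ^ (2 * r) * (n / π) * ((n : ℝ)⁻¹ * π) := by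
              gcongr
              linarith
          _ = _ := by field_simp

/-! ### The Jackson estimate, part (i). -/

lemma fockNorm_eq {α p : ℝ} (hp : 0 < p) {I : ℍ[ℝ]} {f : ℍ[ℝ] → ℍ[ℝ]} (hf : Continuous f) :
    fockNorm α p I f = ENNReal.ofReal (α * p / (2 * π)) ^ (1 / p) *
      eLpNorm (fun z => f (slicePoint I z)) (ENNReal.ofReal p) (weightMeasure α p) := by
  rw [fockNorm, ENNReal.mul_rpow_of_nonneg _ _ (by positivity),
    weightedIntegral_rpow_eq hp (g := fun z => f (slicePoint I z))
      (hf.comp (continuous_slicePoint I))]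

lemma continuous_of_mem_polysDegreeLE {d : ℕ} {P : ℍ[ℝ] → ℍ[ℝ]} (hP : P ∈ polysDegreeLE d) :
    Continuous P := by
  obtain ⟨a, ha⟩ := hP
  rw [funext ha]
  fun_prop

lemma continuous_rotDiff {f : ℍ[ℝ] → ℍ[ℝ]} (hf : Continuous f) (I : ℍ[ℝ]) (k : ℕ) :
    Continuous fun x : ℝ × ℂ => rotDiff I k x.1 f (slicePoint I x.2) := by
  have h1 := continuous_expUnit I
  have h2 := continuous_slicePoint I
  unfold rotDiff
  fun_prop

lemma weightedIntegral_rotDiff_le {α p : ℝ} (hp : 1 ≤ p) {I : ℍ[ℝ]} (hI : I ∈ imagSphere)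
    {f : ℍ[ℝ] → ℍ[ℝ]} (hf : Continuous f) (k : ℕ) {n : ℕ} (hn : 1 ≤ n) (t : ℝ) :
    weightedIntegral α p (fun z => rotDiff I k t f (slicePoint I z)) ≤
      ENNReal.ofReal ((1 + n * |t|) ^ (p * k)) * modulus α p I k f (1 / n) ^ p := by
  have hp0 : 0 < p := by linarith
  have hn0 : (1 : ℝ) ≤ n := by exact_mod_cast hn
  have hu : Continuous fun z => f (slicePoint I z) := hf.comp (continuous_slicePoint I)
  have hrot (h : ℝ) : Continuous (((rotate h - 1) ^ k) fun z => f (slicePoint I z)) :=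
    continuous_rotate_sub_one_pow h k hu
  -- The rotation by `t` is cut into `j` equal steps. The `+ 1` keeps `j` positive and each step at
  -- most `1/n`, while `j ≤ 1 + n|t|`.
  set j := ⌊n * |t|⌋₊ + 1 with hj
  have hj0 : (0 : ℝ) < j := by positivity
  have hj1 : n * |t| ≤ j := by rw [hj]; push_cast; exact (Nat.lt_floor_add_one _).le
  have hj2 : (j : ℝ) ≤ 1 + n * |t| := by
    rw [hj]; push_cast
    linarith [Nat.floor_le (by positivity : 0 ≤ n * |t|)]
  have hh : |t / j| ≤ 1 / n := by
    rw [abs_div, abs_of_pos hj0, div_le_div_iff₀ hj0 (by linarith)]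
    linarith
  have hmod : eLpNorm (((rotate (t / j) - 1) ^ k) fun z => f (slicePoint I z)) (ENNReal.ofReal p)
      (weightMeasure α p) ≤ modulus α p I k f (1 / n) := by
    rw [← weightedIntegral_rpow_eq hp0 (hrot _), ← rotDiff_slicePoint hI]
    exact le_iSup₂ (f := fun (h : ℝ) (_ : |h| ≤ 1 / (n : ℝ)) =>
      weightedIntegral α p (fun z => rotDiff I k h f (slicePoint I z)) ^ (1 / p)) _ hh
  have h1 := eLpNorm_rotate_nat_mul_sub_one_pow_le (α := α) hp (t / j) j k hu
  rw [mul_div_cancel₀ _ hj0.ne'] at h1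
  rw [rotDiff_slicePoint hI, weightedIntegral_eq_eLpNorm_rpow hp0 (hrot t)]
  have h2 : ((j : ℝ≥0∞) ^ k) ≤ ENNReal.ofReal ((1 + n * |t|) ^ k) := by
    rw [ENNReal.ofReal_pow (by positivity), ← ENNReal.ofReal_natCast]
    gcongr
  calc _ ≤ (ENNReal.ofReal ((1 + n * |t|) ^ k) * modulus α p I k f (1 / n)) ^ p :=
        ENNReal.rpow_le_rpow (h1.trans (mul_le_mul' h2 hmod)) hp0.le
    _ = _ := by
        rw [ENNReal.mul_rpow_of_nonneg _ _ hp0.le, ENNReal.ofReal_rpow_of_nonneg (by positivity) hp0.le,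
          ← rpow_natCast, ← rpow_mul (by positivity), mul_comm p]

/-- Since the kernel has mass one, `f q` is the average of the term `s = 0` of the difference, up to
sign; the terms `s ≥ 1` form the integrand of `jacksonOp`. -/
lemma jacksonOp_sub_eq {a f} (hf : HasPowerSeries a f) {I₀ I : ℍ[ℝ]} (hI₀ : I₀ ∈ imagSphere)
    (hI : I ∈ imagSphere) {n : ℕ} (hn : 1 ≤ n) (m r : ℕ) (z : ℂ) :
    (jacksonOp I₀ n m r f - f) (slicePoint I z) = (-1 : ℝ) ^ m • ∫ t in (-π)..π,
      jacksonKernel n r t • rotDiff I (m + 1) t f (slicePoint I z) := by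
  have hκ := continuous_of_mem_cosPolys (jackson_mem_cosPolys hn r)
  have hfc := hf.continuous
  have hexp := continuous_expUnit I
  have hone : ∫ t in (-π)..π, ((1 / jacksonConst n r) • fejerPoly n ^ r) t = 1 := by
    simp only [Pi.smul_apply, Pi.pow_apply, smul_eq_mul]
    rw [intervalIntegral.integral_const_mul, ← jacksonConst_eq, one_div,
      inv_mul_cancel₀ (jacksonConst_pos hn r).ne']
  rw [Pi.sub_apply, jacksonOp_slicePoint hf hI₀ hI hn]
  rw [interval_integral_congr_kernel fun t ht h0 => jacksonKernel_eq ht h0 n r,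
    interval_integral_congr_kernel fun t ht h0 => jacksonKernel_eq ht h0 n r]
  generalize (1 / jacksonConst n r) • fejerPoly n ^ r = κ at hκ hone ⊢
  generalize slicePoint I z = q
  have hdiff (t : ℝ) : rotDiff I (m + 1) t f q = (-1 : ℝ) ^ (m + 1) •
      (f q + ∑ k ∈ Finset.Icc 1 (m + 1),
        ((-1 : ℝ) ^ k * ((m + 1).choose k : ℝ)) • f (q * expUnit I (k * t))) := by
    have hq : f q = ((-1 : ℝ) ^ 0 * ((m + 1).choose 0 : ℝ)) • f (q * expUnit I ((0 : ℕ) * t)) := by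
      simp [expUnit]
    rw [hq, rotDiff, Finset.range_eq_Ico, Finset.sum_eq_sum_Ico_succ_bot (by omega), smul_add,
      Finset.smul_sum]
    simp only [pow_add _ (m + 1), mul_smul, mul_assoc]
    rfl
  have hint : ∫ t in (-π)..π, κ t • rotDiff I (m + 1) t f q = (-1 : ℝ) ^ (m + 1) •
      (f q + ∫ t in (-π)..π, κ t • ∑ k ∈ Finset.Icc 1 (m + 1),
        ((-1 : ℝ) ^ k * ((m + 1).choose k : ℝ)) • f (q * expUnit I (k * t))) := by
    simp only [hdiff, smul_comm (κ _) ((-1 : ℝ) ^ (m + 1)), smul_add (κ _)]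
    rw [intervalIntegral.integral_smul, intervalIntegral.integral_add
      (Continuous.intervalIntegrable (by fun_prop) _ _)
      (Continuous.intervalIntegrable (by fun_prop) _ _), intervalIntegral.integral_smul_const, hone,
      one_smul]
  rw [hint, smul_smul, pow_succ, ← mul_assoc, ← pow_add, Even.neg_one_pow ⟨m, rfl⟩, one_mul,
    neg_one_smul, neg_add]
  abel

lemma fockNorm_jacksonOp_sub_le {α p : ℝ} (hα : 0 < α) (hp : 1 ≤ p) {a f} (hf : HasPowerSeries a f)
    {I₀ I : ℍ[ℝ]} (hI₀ : I₀ ∈ imagSphere) (hI : I ∈ imagSphere) {n : ℕ} (hn : 1 ≤ n) {m r : ℕ}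
    (hr : (p * ((m : ℝ) + 1) + 2) / 2 ≤ r) :
    fockNorm α p I (jacksonOp I₀ n m r f - f) ≤
      ENNReal.ofReal ((((π + 1) * π / 2) ^ (2 * r)) ^ (1 / p) * (α * p / (2 * π)) ^ (1 / p)) *
        modulus α p I (m + 1) f (1 / (n : ℝ)) := by
  have hp0 : 0 < p := by linarith
  have hfc := hf.continuous
  have hp1 : p * (1 / p) = 1 := mul_one_div_cancel hp0.ne'
  have hW : weightedIntegral α p (fun z => (jacksonOp I₀ n m r f - f) (slicePoint I z)) ≤
      ENNReal.ofReal (((π + 1) * π / 2) ^ (2 * r)) *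
        modulus α p I (m + 1) f (1 / (n : ℝ)) ^ p := by
    have e : weightedIntegral α p (fun z => (jacksonOp I₀ n m r f - f) (slicePoint I z))
        = weightedIntegral α p (fun z => ∫ t in (-π)..π,
          jacksonKernel n r t • rotDiff I (m + 1) t f (slicePoint I z)) := by
      simp only [weightedIntegral, jacksonOp_sub_eq hf hI₀ hI hn, enorm_smul]
      simp
    rw [e]
    refine (weightedIntegral_average_le hp (measurable_jacksonKernel n r)
      (jacksonKernel_nonneg hn r) (lintegral_jacksonKernel hn r)
      (G := fun t z => rotDiff I (m + 1) t f (slicePoint I z))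
      (continuous_rotDiff hfc I (m + 1))).trans ?_
    have hK := measurable_jacksonKernel n r
    calc _ ≤ ∫⁻ t in Set.Ioc (-π) π, (ENNReal.ofReal (jacksonKernel n r t) *
          ENNReal.ofReal ((1 + n * |t|) ^ (p * (m + 1 : ℕ)))) *
            modulus α p I (m + 1) f (1 / (n : ℝ)) ^ p := by
          refine lintegral_mono fun t => ?_
          simp only [mul_assoc]
          gcongr
          exact weightedIntegral_rotDiff_le hp hI hfc (m + 1) hn t
      _ = (∫⁻ t in Set.Ioc (-π) π, ENNReal.ofReal (jacksonKernel n r t) *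
          ENNReal.ofReal ((1 + n * |t|) ^ (p * (m + 1 : ℕ)))) *
            modulus α p I (m + 1) f (1 / (n : ℝ)) ^ p := by
          rw [lintegral_mul_const _ (by fun_prop)]
      _ ≤ _ := by
          gcongr
          -- Here `s = p(m+1)`, so the lower bound on `r` is exactly `s + 2 ≤ 2r`.
          refine lintegral_jacksonKernel_mul_le hn ?_
          push_cast
          linarith
  rw [fockNorm]
  calc _ ≤ (ENNReal.ofReal (α * p / (2 * π)) * (ENNReal.ofReal (((π + 1) * π / 2) ^ (2 * r)) *
        modulus α p I (m + 1) f (1 / (n : ℝ)) ^ p)) ^ (1 / p) := by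
        gcongr
    _ = _ := by
        rw [ENNReal.mul_rpow_of_nonneg _ _ (by positivity),
          ENNReal.mul_rpow_of_nonneg _ _ (by positivity), ← ENNReal.rpow_mul, hp1, ENNReal.rpow_one,
          ENNReal.ofReal_mul (by positivity), ← ENNReal.ofReal_rpow_of_nonneg (by positivity)
          (by positivity), ← ENNReal.ofReal_rpow_of_nonneg (by positivity) (by positivity)]
        ring

/-! ### The de la Vallée Poussin estimate, part (ii). -/

lemma fejerOp_mem_polysDegreeLE {a f} (hf : HasPowerSeries a f) {I₀ : ℍ[ℝ]}
    (hI₀ : I₀ ∈ imagSphere) {n : ℕ} (hn : 1 ≤ n) : fejerOp I₀ n f ∈ polysDegreeLE (n - 1) :=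
  ⟨_, fun q => by rw [Nat.sub_add_cancel hn]; exact fejerOp_eq_sum hf hI₀ hn q⟩

lemma valleePoussinOp_mem_polysDegreeLE {a f} (hf : HasPowerSeries a f) {I₀ : ℍ[ℝ]}
    (hI₀ : I₀ ∈ imagSphere) {n : ℕ} (hn : 1 ≤ n) :
    valleePoussinOp I₀ n f ∈ polysDegreeLE (2 * n - 1) :=
  ⟨_, fun q => by
    rw [Nat.sub_add_cancel (by omega : 1 ≤ 2 * n)]; exact valleePoussinOp_eq_sum hf hI₀ hn q⟩

lemma eLpNorm_fejerOp_le {α p : ℝ} (hp : 1 ≤ p) {a f} (hf : HasPowerSeries a f)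
    {I₀ I : ℍ[ℝ]} (hI₀ : I₀ ∈ imagSphere) (hI : I ∈ imagSphere) {n : ℕ} (hn : 1 ≤ n) :
    eLpNorm (fun z => fejerOp I₀ n f (slicePoint I z)) (ENNReal.ofReal p) (weightMeasure α p) ≤
      eLpNorm (fun z => f (slicePoint I z)) (ENNReal.ofReal p) (weightMeasure α p) := by
  have hp0 : 0 < p := by linarith
  have hs := continuous_slicePoint I
  have he := continuous_expUnit I
  have hfc := hf.continuous
  have hF := continuous_of_mem_polysDegreeLE (fejerOp_mem_polysDegreeLE hf hI₀ hn)
  rw [← weightedIntegral_rpow_eq hp0 (g := fun z => fejerOp I₀ n f (slicePoint I z)) (hF.comp hs),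
    ← weightedIntegral_rpow_eq hp0 (g := fun z => f (slicePoint I z)) (hfc.comp hs)]
  refine ENNReal.rpow_le_rpow ?_ (by positivity)
  simp only [fejerOp_slicePoint hf hI₀ hI hn]
  refine (weightedIntegral_average_le hp (measurable_fejerKernel n) (fejerKernel_nonneg n)
    (lintegral_fejerKernel hn) (G := fun t z => f (slicePoint I z * expUnit I t)) ?_).trans ?_
  · change Continuous fun x : ℝ × ℂ => f (slicePoint I x.2 * expUnit I x.1)
    fun_prop
  · have hrot (t : ℝ) : weightedIntegral α p (fun z => f (slicePoint I z * expUnit I t))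
        = weightedIntegral α p (fun z => f (slicePoint I z)) := by
      simp only [slicePoint_mul_expUnit hI]
      exact weightedIntegral_rotate α p t (u := fun z => f (slicePoint I z))
    have hK := measurable_fejerKernel n
    simp only [hrot]
    rw [lintegral_mul_const _ (by fun_prop), lintegral_fejerKernel hn, one_mul]

lemma eLpNorm_valleePoussinOp_le {α p : ℝ} (hp : 1 ≤ p) {a f} (hf : HasPowerSeries a f)
    {I₀ I : ℍ[ℝ]} (hI₀ : I₀ ∈ imagSphere) (hI : I ∈ imagSphere) {n : ℕ} (hn : 1 ≤ n) :
    eLpNorm (fun z => valleePoussinOp I₀ n f (slicePoint I z)) (ENNReal.ofReal p)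
        (weightMeasure α p) ≤
      3 * eLpNorm (fun z => f (slicePoint I z)) (ENNReal.ofReal p) (weightMeasure α p) := by
  have hs := continuous_slicePoint I
  have hc {k : ℕ} (hk : 1 ≤ k) : Continuous fun z => fejerOp I₀ k f (slicePoint I z) :=
    (continuous_of_mem_polysDegreeLE (fejerOp_mem_polysDegreeLE hf hI₀ hk)).comp hs
  have h2n : 1 ≤ 2 * n := by omega
  have h2 : ‖(2 : ℝ)‖ₑ = 2 := by
    rw [Real.enorm_of_nonneg zero_le_two]; simp
  calc _ ≤ eLpNorm ((2 : ℝ) • fun z => fejerOp I₀ (2 * n) f (slicePoint I z)) (ENNReal.ofReal p)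
          (weightMeasure α p) + eLpNorm (fun z => fejerOp I₀ n f (slicePoint I z))
          (ENNReal.ofReal p) (weightMeasure α p) :=
        eLpNorm_sub_le ((hc h2n).const_smul _).aestronglyMeasurable (hc hn).aestronglyMeasurable
          (by simpa using hp)
    _ ≤ 2 * eLpNorm (fun z => f (slicePoint I z)) (ENNReal.ofReal p) (weightMeasure α p)
        + eLpNorm (fun z => f (slicePoint I z)) (ENNReal.ofReal p) (weightMeasure α p) := by
        rw [eLpNorm_const_smul, h2]
        gcongr
        · exact eLpNorm_fejerOp_le hp hf hI₀ hI h2n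
        · exact eLpNorm_fejerOp_le hp hf hI₀ hI hn
    _ = _ := by ring

/-- Convexity of `x^p` gives `(2 + 1)^p ≤ 2^{p-1}(2^p + 1)`. So the constant in the theorem
dominates the bound `2 + 1` from the triangle inequality. -/
lemma three_le_rpow {p : ℝ} (hp : 1 ≤ p) :
    (3 : ℝ) ≤ 2 ^ ((p - 1) / p) * (2 ^ p + 1) ^ (1 / p) := by
  have hp0 : 0 < p := by linarith
  have h : (3 : ℝ) ^ p ≤ 2 ^ (p - 1) * (2 ^ p + 1) := by
    have h := NNReal.rpow_add_le_mul_rpow_add_rpow 2 1 hp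
    rw [NNReal.one_rpow] at h
    have h' : (((2 + 1 : NNReal) ^ p : NNReal) : ℝ) ≤ ((2 ^ (p - 1) * (2 ^ p + 1) : NNReal) : ℝ) := h
    push_cast at h'
    norm_num at h' ⊢
    exact h'
  calc (3 : ℝ) = ((3 : ℝ) ^ p) ^ (1 / p) := by
        rw [← rpow_mul (by norm_num), mul_one_div_cancel hp0.ne', rpow_one]
    _ ≤ (2 ^ (p - 1) * (2 ^ p + 1)) ^ (1 / p) := rpow_le_rpow (by positivity) h (by positivity)
    _ = _ := by
        rw [mul_rpow (by positivity) (by positivity), ← rpow_mul (by norm_num), mul_one_div]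

/-- `V_n` acts linearly on coefficients and has multiplier `1` up to degree `n`, so it fixes `P`. -/
lemma valleePoussinOp_sub_eq {a f} (hf : HasPowerSeries a f) {I₀ : ℍ[ℝ]} (hI₀ : I₀ ∈ imagSphere)
    {n : ℕ} (hn : 1 ≤ n) {P : ℍ[ℝ] → ℍ[ℝ]} (hP : P ∈ polysDegreeLE n) :
    valleePoussinOp I₀ n f - f = valleePoussinOp I₀ n (f - P) - (f - P) := by
  obtain ⟨c, hc⟩ := hP
  have hPs := hasPowerSeries_of_polynomial hc
  funext q
  have hV : valleePoussinOp I₀ n P q = P q := by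
    rw [valleePoussinOp_eq_sum hPs hI₀ hn, hc q,
      ← Finset.sum_subset (Finset.range_subset_range.2 (by omega : n + 1 ≤ 2 * n))]
    · refine Finset.sum_congr rfl fun j hj => ?_
      rw [if_pos hj, if_pos (by simpa [Nat.lt_succ_iff] using hj), one_smul]
    · intro j _ hj
      rw [if_neg hj, smul_zero, mul_zero]
  have hsub : valleePoussinOp I₀ n (f - P) q = valleePoussinOp I₀ n f q - valleePoussinOp I₀ n P q := by
    rw [valleePoussinOp_eq_sum (hf.sub hPs) hI₀ hn, valleePoussinOp_eq_sum hf hI₀ hn,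
      valleePoussinOp_eq_sum hPs hI₀ hn, ← Finset.sum_sub_distrib]
    exact Finset.sum_congr rfl fun j _ => by rw [Pi.sub_apply, smul_sub, mul_sub]
  simp only [Pi.sub_apply, hsub, hV]
  abel

lemma fockNorm_valleePoussinOp_sub_le {α p : ℝ} (hp : 1 ≤ p) {a f} (hf : HasPowerSeries a f)
    {I₀ I : ℍ[ℝ]} (hI₀ : I₀ ∈ imagSphere) (hI : I ∈ imagSphere) {n : ℕ} (hn : 1 ≤ n) :
    fockNorm α p I (valleePoussinOp I₀ n f - f) ≤
      ENNReal.ofReal ((2 : ℝ) ^ ((p - 1) / p) * ((2 : ℝ) ^ p + 1) ^ (1 / p) + 1) *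
        bestApprox α p I n f := by
  have hp0 : 0 < p := by linarith
  have hs := continuous_slicePoint I
  have h3 := three_le_rpow hp
  set B := (2 : ℝ) ^ ((p - 1) / p) * ((2 : ℝ) ^ p + 1) ^ (1 / p) + 1
  have hB : (4 : ℝ≥0∞) ≤ ENNReal.ofReal B := by
    rw [← ENNReal.ofReal_ofNat]
    exact ENNReal.ofReal_le_ofReal (by linarith)
  have hB0 : ENNReal.ofReal B ≠ 0 := by
    intro h
    simp [h] at hB
  -- The constant is nonzero and finite, so it moves inside the infimum and each `P` can be treated
  -- separately.
  simp only [bestApprox, ENNReal.mul_iInf_of_ne hB0 ENNReal.ofReal_ne_top]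
  refine le_iInf₂ fun P hP => ?_
  rw [valleePoussinOp_sub_eq hf hI₀ hn hP]
  have hg := hf.sub (hasPowerSeries_of_polynomial hP.choose_spec)
  generalize f - P = g at hg
  have hgc := hg.continuous
  have hVc := continuous_of_mem_polysDegreeLE (valleePoussinOp_mem_polysDegreeLE hg hI₀ hn)
  rw [fockNorm_eq hp0 (hVc.sub hgc), fockNorm_eq hp0 hgc, mul_left_comm]
  gcongr
  calc _ ≤ eLpNorm (fun z => valleePoussinOp I₀ n g (slicePoint I z)) (ENNReal.ofReal p)
          (weightMeasure α p) + eLpNorm (fun z => g (slicePoint I z)) (ENNReal.ofReal p)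
          (weightMeasure α p) :=
        eLpNorm_sub_le (hVc.comp hs).aestronglyMeasurable (hgc.comp hs).aestronglyMeasurable
          (by simpa using hp)
    _ ≤ 3 * eLpNorm (fun z => g (slicePoint I z)) (ENNReal.ofReal p) (weightMeasure α p)
        + eLpNorm (fun z => g (slicePoint I z)) (ENNReal.ofReal p) (weightMeasure α p) := by
        gcongr
        exact eLpNorm_valleePoussinOp_le hp hg hI₀ hI hn
    _ = 4 * eLpNorm (fun z => g (slicePoint I z)) (ENNReal.ofReal p) (weightMeasure α p) := by
        ring
    _ ≤ _ := by gcongr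

end SliceFock

end

theorem theorem4p5 (p : ℝ) (hp : 1 ≤ p) :
    (∀ m r : ℕ, IsLeast {s : ℕ | (p * ((m : ℝ) + 1) + 2) / 2 ≤ (s : ℝ)} r →
      ∃ C : ℝ, 0 < C ∧ ∀ α : ℝ, 0 < α → ∀ f ∈ fockSlice α p,
        ∀ I₀ ∈ imagSphere, ∀ n : ℕ, 1 ≤ n →
          jacksonOp I₀ n m r f ∈ polysDegreeLE (r * (n - 1)) ∧
          ∀ I ∈ imagSphere,
            fockNorm α p I (jacksonOp I₀ n m r f - f) ≤
              ENNReal.ofReal (C * (α * p / (2 * Real.pi)) ^ (1 / p)) *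
                modulus α p I (m + 1) f (1 / (n : ℝ))) ∧
    (∀ α : ℝ, 0 < α → ∀ f ∈ fockSlice α p,
      ∀ I₀ ∈ imagSphere, ∀ n : ℕ, 1 ≤ n →
        valleePoussinOp I₀ n f ∈ polysDegreeLE (2 * n - 1) ∧
        ∀ I ∈ imagSphere,
          fockNorm α p I (valleePoussinOp I₀ n f - f) ≤
            ENNReal.ofReal
              ((2 : ℝ) ^ ((p - 1) / p) * ((2 : ℝ) ^ p + 1) ^ (1 / p) + 1) *
              bestApprox α p I n f) := by
  -- The constant is the `p`-th root of the kernel moment bound, which involves neither `α`, `f` nor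
  -- `n`.
  refine ⟨fun m r hr => ⟨(((Real.pi + 1) * Real.pi / 2) ^ (2 * r)) ^ (1 / p), ?_,
    fun α hα f hf I₀ hI₀ n hn => ?_⟩, fun α hα f hf I₀ hI₀ n hn => ?_⟩
  · have := Real.pi_pos
    positivity
  · obtain ⟨a, ha⟩ := hf.1.exists_hasPowerSeries hI₀
    exact ⟨jacksonOp_mem_polysDegreeLE ha hI₀ hn m r,
      fun I hI => fockNorm_jacksonOp_sub_le hα hp ha hI₀ hI hn hr.1⟩
  · obtain ⟨a, ha⟩ := hf.1.exists_hasPowerSeries hI₀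
    exact ⟨valleePoussinOp_mem_polysDegreeLE ha hI₀ hn,
      fun I hI => fockNorm_valleePoussinOp_sub_le hp ha hI₀ hI hn⟩
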